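/- Let $F$ be a field and $X$ a compact geodesic metric space (any two points $x,y$ are joined by an isometrically embedded interval of length $d(x,y)$) which is $F$-semi-locally simply connected: $X$ is path-connected and every $x\in X$ has a neighbourhood $U$ for which $H_1(U;F)\to H_1(X;F)$ (singular homology) is zero. Suppose $H_1(X;F)\cong F^n$, and let $a_1,\dots,a_n$ be loops in $X$ with lengths $l_i=\operatorname{length}(a_i)\in[0,\infty]$ satisfying $l_i\le l_j$ for $i<j$. Definitions. A *base* is a collection of loops $b_1,\dots,b_n$ of nondecreasing lengths whose classes generate $H_1(X;F)=F^n$; it is *lexicographically minimal* if its vector of lengths is lexicographically minimal among the vectors of lengths of all bases. For $r>0$, $\operatorname{Rips}(X,r)$ is the simplicial complex of nonempty finite subsets of $X$ of diameter $<r$. A persistence is a family $\{A_r\}_{r>0}$ of $F$-vector spaces with compatible bonding maps $A_p\to A_q$ for $p\le q$; isomorphisms of persistences are families of isomorphisms which commute with the bonding maps. $\{H_1(\operatorname{Rips}(X,r);F)\}_{r>0}$ has the bonding maps induced by inclusions. For an interval $J$, $\mathbb I_J$ is the persistence with value $F$ at $r\in J$ and $0$ at $r\notin J$, whose bonding maps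 are identities between nonzero values and zero otherwise. A number $p>0$ is a critical value of a persistence if for all small enough $\varepsilon>0$ the map $A_{p-\varepsilon}\to A_p$ is not an isomorphism, or if for all $\varepsilon>0$ the map $A_p\to A_{p+\varepsilon}$ is not an isomorphism. An $r$-sample of a loop $\alpha\colon[0,1]\to X$ is the cyclic sequence $\alpha(t_0),\dots,\alpha(t_m)$, for some $0\le t_0<\dots<t_m\le1$ such that $\alpha$ maps each $[t_i,t_{i+1}]$, and also $[0,t_0]\cup[t_m,1]$, to a set of diameter $<r$; it defines a class in $H_1(\operatorname{Rips}(X,r);F)$. For $r>0$ let $k_r=\max\{i: l_i/3<r\}$ ($k_r=0$ if there is no such $i$), and let $Q_r=H_1(X;F)/\langle [a_1],\dots,[a_{k_r}]\rangle$, with the natural quotient maps as bonding maps. Then: 1. $a_1,\dots,a_n$ is a lexicographically minimal base if and only if $$\{H_1(\operatorname{Rips}(X,r);F)\}_{r>0}=\{Q_r\}_{r>0}\cong\bigoplus_{i=1}^n\mathbb I_{(0,l_i/3]},$$ where "$=$" means that there is an isomorphism of persistences from the right side to the left side which sends the class of every loop $\alpha$ to the class of every $r$-sample of $\alpha$, for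 all $r>0$. 2. The equivalence in (1) also holds if "$=$" is read as the existence of an arbitrary isomorphism of persistences. 3. If $a_1,\dots,a_n$ is a lexicographically minimal base, then the set of critical values of $\{H_1(\operatorname{Rips}(X,r);F)\}_{r>0}$ is $\{l_1/3,\dots,l_n/3\}$. -/

import Mathlib

open CategoryTheory Limits Simplicial

universe v w

namespace GeodesicPersistence

noncomputable section

/-! ### Geodesic spaces, loops and their lengths -/

/-- A metric space is geodesic if any two points `x`, `y` are joined by an isometric copy of the
interval `[0, d(x, y)]`. -/
def IsGeodesicSpace (X : Type w) [MetricSpace X] : Prop :=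
  ∀ x y : X, ∃ γ : ℝ → X, γ 0 = x ∧ γ (dist x y) = y ∧
    ∀ s ∈ Set.Icc 0 (dist x y), ∀ t ∈ Set.Icc 0 (dist x y), dist (γ s) (γ t) = |s - t|

/-- A (free) loop in `X`: a continuous closed path, parametrized by the unit interval. -/
structure Loop (X : Type w) [TopologicalSpace X] where
  base : X
  path : Path base base

/-- The length of a loop; it is `∞` exactly when the loop is not rectifiable. -/
def Loop.length {X : Type w} [MetricSpace X] (α : Loop X) : ENNReal :=
  eVariationOn α.path Set.univ

/-! ### First homology and homology classes of cycles of edges -/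

/-- The field `F`, as the coefficient object of homology (lifted to the needed universe). -/
abbrev coeff (F : Type v) [Field F] : ModuleCat.{max v w} F :=
  ModuleCat.of F (ULift.{w} F)

/-- The edges `e 0, …, e m` of a simplicial set form a cycle: the target of each edge is the source
of the next one, cyclically (`i + 1` is addition in `Fin (m + 1)`, so `m + 1 = 0`). -/
def IsEdgeCycle (S : SSet.{w}) {m : ℕ} (e : Fin (m + 1) → S _⦋1⦌) : Prop :=
  ∀ i, S.δ 0 (e i) = S.δ 1 (e (i + 1))

/-- The chain `∑ i, e i`, as the morphism `F ⟶ C₁` which sends `1` to it. -/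
def edgeChain (F : Type v) [Field F] (S : SSet.{w}) {m : ℕ} (e : Fin (m + 1) → S _⦋1⦌) :
    coeff.{v, w} F ⟶ (S.chainComplex (coeff.{v, w} F)).X 1 :=
  ∑ i, S.ιChainComplex (e i)

theorem edgeChain_d (F : Type v) [Field F] (S : SSet.{w}) {m : ℕ} (e : Fin (m + 1) → S _⦋1⦌)
    (he : IsEdgeCycle S e) :
    edgeChain F S e ≫ (S.chainComplex (coeff.{v, w} F)).d 1 0 = 0 := by
  have h : ∀ i, S.ιChainComplex (R := coeff.{v, w} F) (e i) ≫
      (S.chainComplex (coeff.{v, w} F)).d 1 0 =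
      S.ιChainComplex (S.δ 1 (e (i + 1))) - S.ιChainComplex (S.δ 1 (e i)) := by
    intro i
    have := S.ιChainComplex_d (R := coeff.{v, w} F) (n := 0) (e i)
    rw [this, Fin.sum_univ_two, he i]
    simp [sub_eq_add_neg]
  rw [edgeChain, Preadditive.sum_comp]
  simp only [h]
  rw [Finset.sum_sub_distrib, sub_eq_zero]
  exact Equiv.sum_comp (Equiv.addRight (1 : Fin (m + 1)))
    fun i => S.ιChainComplex (R := coeff.{v, w} F) (S.δ 1 (e i))

/-- The class of `∑ i, e i` in the first homology of the simplicial set `S`. -/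
def edgeCycleClass (F : Type v) [Field F] (S : SSet.{w}) {m : ℕ} (e : Fin (m + 1) → S _⦋1⦌)
    (he : IsEdgeCycle S e) : (S.homology (coeff.{v, w} F) 1 : ModuleCat.{max v w} F) :=
  let C := S.chainComplex (coeff.{v, w} F)
  let f : coeff.{v, w} F ⟶ C.homology 1 :=
    C.liftCycles (edgeChain F S e) 0 (by simp) (edgeChain_d F S e he) ≫ C.homologyπ 1
  f.hom (ULift.up 1)

/-- Singular homology `H₁(X; F)`. -/
abbrev H1 (F : Type v) [Field F] (X : Type w) [TopologicalSpace X] : ModuleCat.{max v w} F :=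
  ((AlgebraicTopology.singularHomologyFunctor (ModuleCat.{max v w} F) 1).obj
    (coeff.{v, w} F)).obj (TopCat.of X)

/-- The map `H₁(U; F) → H₁(X; F)` induced by the inclusion of a subspace. -/
def H1Incl (F : Type v) [Field F] (X : Type w) [TopologicalSpace X] (U : Set X) :
    H1.{v, w} F U ⟶ H1.{v, w} F X :=
  ((AlgebraicTopology.singularHomologyFunctor (ModuleCat.{max v w} F) 1).obj
    (coeff.{v, w} F)).map (TopCat.ofHom ⟨Subtype.val, continuous_subtype_val⟩)

/-- `X` is `F`-semi-locally simply connected. -/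
def IsSLSC (F : Type v) [Field F] (X : Type w) [TopologicalSpace X] : Prop :=
  PathConnectedSpace X ∧ ∀ x : X, ∃ U ∈ nhds x, H1Incl.{v, w} F X U = 0

/-- A loop, as a singular `1`-simplex. -/
def Loop.singularEdge {X : Type w} [TopologicalSpace X] (α : Loop X) :
    (TopCat.toSSet.obj (TopCat.of X)) _⦋1⦌ :=
  ((TopCat.of X).toSSetObjEquiv (.op ⦋1⦌)).symm
    (α.path.toContinuousMap.comp (stdSimplexHomeomorphUnitInterval : C(stdSimplex ℝ (Fin 2), _)))

theorem Loop.isEdgeCycle {X : Type w} [TopologicalSpace X] (α : Loop X) :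
    IsEdgeCycle (m := 0) (TopCat.toSSet.obj (TopCat.of X)) fun _ => α.singularEdge := by
  intro i
  apply ((TopCat.of X).toSSetObjEquiv (.op ⦋0⦌)).injective
  ext x
  have key : ∀ k : Fin 2, (TopCat.of X).toSSetObjEquiv (.op ⦋0⦌)
      ((TopCat.toSSet.obj (TopCat.of X)).δ k α.singularEdge) x = α.base := by
    intro k
    change α.path (stdSimplexHomeomorphUnitInterval
      (stdSimplex.map (SimplexCategory.δ k).toOrderHom x)) = α.base
    have hx : x = stdSimplex.vertex 0 := Subsingleton.elim (α := stdSimplex ℝ (Fin 1)) _ _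
    rw [hx, stdSimplex.map_vertex]
    fin_cases k
    · exact α.path.target
    · exact α.path.source
  exact (key 0).trans (key 1).symm

/-- The homology class `[α] ∈ H₁(X; F)` of a loop. -/
def Loop.homologyClass (F : Type v) [Field F] {X : Type w} [TopologicalSpace X] (α : Loop X) :
    H1.{v, w} F X :=
  edgeCycleClass F _ _ α.isEdgeCycle

/-! ### Rips complexes and their homology -/

/-- The open Rips complex: its faces are the nonempty finite subsets of diameter `< r`. -/
def rips (X : Type w) [MetricSpace X] (r : Set.Ioi (0 : ℝ)) : AbstractSimplicialComplex X where
  faces := {σ | σ.Nonempty ∧ Metric.diam (σ : Set X) < r}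
  isRelLowerSet_faces := fun _ hσ => ⟨hσ.1, fun _ hτ hne =>
    ⟨hne, (Metric.diam_mono (by exact_mod_cast hτ) (Finset.finite_toSet _).isBounded).trans_lt hσ.2⟩⟩
  singleton_mem := fun x => ⟨Finset.singleton_nonempty x, by simpa using Set.mem_Ioi.1 r.2⟩

/-- The simplicial set of ordered simplices of an abstract simplicial complex `K`: an `n`-simplex is
an `(n + 1)`-tuple of vertices, repetitions allowed, which span a face of `K`. Its chain complex
is the ordered chain complex of `K` and its homology is the simplicial homology of `K`. -/
def orderedSimplices {V : Type w} (K : AbstractSimplicialComplex V) : SSet.{w} where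
  obj n := {f : Fin (n.unop.len + 1) → V // ∃ σ ∈ K.faces, (σ : Set V) = Set.range f}
  map θ := TypeCat.ofHom fun f => ⟨f.1 ∘ θ.unop.toOrderHom, by
    classical
    obtain ⟨σ, hσ, hf⟩ := f.2
    refine ⟨Finset.univ.image (f.1 ∘ θ.unop.toOrderHom),
      (K.isRelLowerSet_faces hσ).2 ?_ (Finset.univ_nonempty.image _), by simp [Function.comp_def]⟩
    rw [← Finset.coe_subset, hf]
    rw [Finset.coe_image, Finset.coe_univ, Set.image_univ]
    exact Set.range_comp_subset_range _ _⟩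

/-- The inclusion of simplicial sets induced by an inclusion of simplicial complexes. -/
def orderedSimplicesMap {V : Type w} {K L : AbstractSimplicialComplex V} (h : K ≤ L) :
    orderedSimplices K ⟶ orderedSimplices L where
  app n := TypeCat.ofHom fun f => ⟨f.1, by
    obtain ⟨σ, hσ, hf⟩ := f.2
    exact ⟨σ, h hσ, hf⟩⟩

/-- A persistence of `F`-vector spaces indexed by `r > 0`. Isomorphisms of persistences are
isomorphisms of functors. -/
abbrev Persistence (F : Type v) [Field F] := Set.Ioi (0 : ℝ) ⥤ ModuleCat.{max v w} F

theorem rips_mono (X : Type w) [MetricSpace X] {p q : Set.Ioi (0 : ℝ)} (h : p ≤ q) :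
    rips X p ≤ rips X q :=
  fun _ hσ => ⟨hσ.1, hσ.2.trans_le h⟩

/-- The open Rips filtration of `X`. -/
def ripsFiltration (X : Type w) [MetricSpace X] : Set.Ioi (0 : ℝ) ⥤ SSet.{w} where
  obj r := orderedSimplices (rips X r)
  map h := orderedSimplicesMap (rips_mono X (leOfHom h))

/-- The persistence `{H₁(Rips(X, r); F)}_{r > 0}`. -/
def ripsPersistence (F : Type v) [Field F] (X : Type w) [MetricSpace X] : Persistence.{v, w} F :=
  ripsFiltration X ⋙ SSet.homologyFunctor (coeff.{v, w} F) 1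

/-! ### `r`-loops and samples -/

/-- An `r`-loop `x₀, x₁, …, x_m, x₀`: consecutive points (cyclically) are at distance `< r`. -/
structure RLoop (X : Type w) [MetricSpace X] (r : Set.Ioi (0 : ℝ)) where
  m : ℕ
  pt : Fin (m + 1) → X
  dist_lt : ∀ i, dist (pt i) (pt (i + 1)) < r

/-- The edge from `x_i` to `x_{i+1}` of an `r`-loop. -/
def RLoop.edge {X : Type w} [MetricSpace X] {r : Set.Ioi (0 : ℝ)} (L : RLoop X r)
    (i : Fin (L.m + 1)) : (orderedSimplices (rips X r)) _⦋1⦌ :=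
  ⟨![L.pt i, L.pt (i + 1)], by
    classical
    refine ⟨{L.pt i, L.pt (i + 1)}, ⟨Finset.insert_nonempty _ _, ?_⟩, by simp [Set.pair_comm]⟩
    simpa [Metric.diam_pair] using L.dist_lt i⟩

theorem RLoop.isEdgeCycle {X : Type w} [MetricSpace X] {r : Set.Ioi (0 : ℝ)} (L : RLoop X r) :
    IsEdgeCycle (orderedSimplices (rips X r)) L.edge := by
  intro i
  apply Subtype.ext
  funext j
  have : j = 0 := Subsingleton.elim (α := Fin 1) j 0
  subst this
  rfl

/-- The homology class `[L] ∈ H₁(Rips(X, r); F)` of an `r`-loop. -/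
def RLoop.homologyClass (F : Type v) [Field F] {X : Type w} [MetricSpace X]
    {r : Set.Ioi (0 : ℝ)} (L : RLoop X r) : (ripsPersistence.{v, w} F X).obj r :=
  edgeCycleClass F _ _ L.isEdgeCycle

/-- The `r`-loop `L` is (the `r`-loop of) an `r`-sample of the loop `α`: its points are
`α t₀, …, α t_m` for some `0 ≤ t₀ < … < t_m ≤ 1`, where `α` maps each `[t_i, t_{i+1}]`, as well as
`[0, t₀] ∪ [t_m, 1]`, to a set of diameter `< r`. -/
def RLoop.IsSampleOf {X : Type w} [MetricSpace X] {r : Set.Ioi (0 : ℝ)} (L : RLoop X r)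
    (α : Loop X) : Prop :=
  ∃ t : Fin (L.m + 1) → unitInterval, StrictMono t ∧ (∀ i, L.pt i = α.path (t i)) ∧
    (∀ i : Fin L.m, Metric.diam (α.path '' Set.Icc (t i.castSucc) (t i.succ)) < r) ∧
    Metric.diam (α.path '' (Set.Iic (t 0) ∪ Set.Ici (t (Fin.last L.m)))) < r

/-! ### Interval persistences, direct sums, critical values -/

/-- The value at `r` of the interval persistence of `I`: `F` if `r ∈ I`, and `0` otherwise. -/
def intervalObj (F : Type v) [Field F] (I : Set (Set.Ioi (0 : ℝ))) (r : Set.Ioi (0 : ℝ)) :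
    Submodule F (ULift.{w} F) where
  carrier := {x | r ∉ I → x = 0}
  add_mem' ha hb h := by rw [ha h, hb h, add_zero]
  zero_mem' _ := rfl
  smul_mem' c x hx h := by rw [hx h, smul_zero]

open Classical in
/-- The bonding map of an interval persistence from `p` to `q`: the identity if `q ∈ I` (and
`p ∈ I`), and zero otherwise. -/
def intervalMap (F : Type v) [Field F] (I : Set (Set.Ioi (0 : ℝ))) (p q : Set.Ioi (0 : ℝ)) :
    intervalObj.{v, w} F I p →ₗ[F] intervalObj.{v, w} F I q where
  toFun x := if h : q ∈ I then ⟨x.1, fun h' => absurd h h'⟩ else 0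
  map_add' x y := by split_ifs <;> [rfl; simp]
  map_smul' c x := by split_ifs <;> [rfl; simp]

/-- The interval persistence of an interval `I` of positive reals. -/
def intervalPersistence (F : Type v) [Field F] (I : Set (Set.Ioi (0 : ℝ))) (hI : I.OrdConnected) :
    Persistence.{v, w} F where
  obj r := ModuleCat.of F (intervalObj.{v, w} F I r)
  map {p q} _ := ModuleCat.ofHom (intervalMap F I p q)
  map_id r := by
    refine ModuleCat.hom_ext (LinearMap.ext fun x => Subtype.ext ?_)
    by_cases h : r ∈ I
    · simp [intervalMap, h]
    · simp [intervalMap, h, x.2 h]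
  map_comp {p q s} f g := by
    refine ModuleCat.hom_ext (LinearMap.ext fun x => Subtype.ext ?_)
    by_cases hs : s ∈ I
    · by_cases hp : p ∈ I
      · have hq : q ∈ I := hI.out hp hs ⟨leOfHom f, leOfHom g⟩
        simp [intervalMap, hs, hq]
      · have hx : x = 0 := Subtype.ext (x.2 hp)
        simp [hx]
    · simp [intervalMap, hs]

/-- The interval `(0, d]`, where `d = ∞` is allowed. -/
def Ioc0 (d : ENNReal) : Set (Set.Ioi (0 : ℝ)) := {r | ENNReal.ofReal r ≤ d}

theorem ordConnected_Ioc0 (d : ENNReal) : (Ioc0 d).OrdConnected :=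
  ⟨fun _ _ _ hq _ hr => (ENNReal.ofReal_le_ofReal hr.2).trans hq⟩

/-- The direct sum of a family of persistences. -/
def directSum (F : Type v) [Field F] {n : ℕ} (M : Fin n → Persistence.{v, w} F) :
    Persistence.{v, w} F where
  obj r := ModuleCat.of F (DirectSum (Fin n) fun i => (M i).obj r)
  map f := ModuleCat.ofHom (DirectSum.lmap fun i => ((M i).map f).hom)
  map_id r := by
    refine ModuleCat.hom_ext (DirectSum.linearMap_ext _ fun i => LinearMap.ext fun x => ?_)
    simp
  map_comp f g := by
    refine ModuleCat.hom_ext (DirectSum.linearMap_ext _ fun i => LinearMap.ext fun x => ?_)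
    simp [DirectSum.lmap_lof]

/-- `p` is a left critical value of `M`. -/
def IsLeftCritical {F : Type v} [Field F] (M : Persistence.{v, w} F) (p : Set.Ioi (0 : ℝ)) : Prop :=
  ∃ δ > (0 : ℝ), ∀ (q : Set.Ioi (0 : ℝ)) (h : q < p), (p : ℝ) - δ < q →
    ¬ IsIso (M.map (homOfLE h.le))

/-- `p` is a right critical value of `M`. -/
def IsRightCritical {F : Type v} [Field F] (M : Persistence.{v, w} F) (p : Set.Ioi (0 : ℝ)) :
    Prop :=
  ∀ (q : Set.Ioi (0 : ℝ)) (h : p < q), ¬ IsIso (M.map (homOfLE h.le))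

/-- `p > 0` is a critical value of `M`. -/
def IsCritical {F : Type v} [Field F] (M : Persistence.{v, w} F) (p : Set.Ioi (0 : ℝ)) : Prop :=
  IsLeftCritical M p ∨ IsRightCritical M p

/-! ### Bases of loops and the quotient persistence -/

/-- The loops `a₁, …, a_n` form a base of `H₁(X; F) = Fⁿ`: they are ordered by length, and their
classes generate. -/
def IsBase (F : Type v) [Field F] {X : Type w} [MetricSpace X] {n : ℕ} (a : Fin n → Loop X) :
    Prop :=
  Nonempty (H1.{v, w} F X ≃ₗ[F] (Fin n → F)) ∧ (Monotone fun i => (a i).length) ∧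
    Submodule.span F (Set.range fun i => (a i).homologyClass F) = ⊤

/-- A base whose length vector is lexicographically minimal amongst those of all bases. -/
def IsLexMinBase (F : Type v) [Field F] {X : Type w} [MetricSpace X] {n : ℕ}
    (a : Fin n → Loop X) : Prop :=
  IsBase.{v, w} F a ∧ ∀ b : Fin n → Loop X, IsBase.{v, w} F b →
    toLex (fun i => (a i).length) ≤ toLex (fun i => (b i).length)

/-- `k_r = max {i | l_i / 3 < r}`, where the loops are numbered from `1` to `n` (so that loop number
`i + 1` is `a i`), and `k_r = 0` if there is no such `i`. -/
def kIndex {X : Type w} [MetricSpace X] {n : ℕ} (a : Fin n → Loop X) (r : Set.Ioi (0 : ℝ)) : ℕ :=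
  (Finset.univ.filter fun i => (a i).length / 3 < ENNReal.ofReal r).sup fun i => (i : ℕ) + 1

theorem kIndex_mono {X : Type w} [MetricSpace X] {n : ℕ} (a : Fin n → Loop X)
    {p q : Set.Ioi (0 : ℝ)} (h : p ≤ q) : kIndex a p ≤ kIndex a q :=
  Finset.sup_mono fun i hi => by
    simp only [Finset.mem_filter, Finset.mem_univ, true_and] at hi ⊢
    exact hi.trans_le (ENNReal.ofReal_le_ofReal h)

/-- The span of `[a₁], …, [a_{k_r}]` in `H₁(X; F)`. -/
def shortSpan (F : Type v) [Field F] {X : Type w} [MetricSpace X] {n : ℕ} (a : Fin n → Loop X)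
    (r : Set.Ioi (0 : ℝ)) : Submodule F (H1.{v, w} F X) :=
  Submodule.span F ((fun i => (a i).homologyClass F) '' {i | (i : ℕ) < kIndex a r})

theorem shortSpan_mono (F : Type v) [Field F] {X : Type w} [MetricSpace X] {n : ℕ}
    (a : Fin n → Loop X) {p q : Set.Ioi (0 : ℝ)} (h : p ≤ q) :
    shortSpan.{v, w} F a p ≤ shortSpan F a q :=
  Submodule.span_mono (Set.image_mono fun _ hi => lt_of_lt_of_le hi (kIndex_mono a h))

/-- The persistence `{M / W_r}_{r > 0}` of a nondecreasing family of subspaces `W_r` of `M`, with the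
natural quotient maps. -/
def quotientsOf (F : Type v) [Field F] (M : ModuleCat.{max v w} F)
    (W : Set.Ioi (0 : ℝ) →o Submodule F M) : Persistence.{v, w} F where
  obj r := ModuleCat.of F (M ⧸ W r)
  map f := ModuleCat.ofHom (Submodule.factor (W.monotone (leOfHom f)))
  map_id r := by
    refine ModuleCat.hom_ext (Submodule.linearMap_qext _ (LinearMap.ext fun x => ?_))
    rfl
  map_comp f g := by
    refine ModuleCat.hom_ext (Submodule.linearMap_qext _ (LinearMap.ext fun x => ?_))
    rfl

/-- The persistence `{H₁(X; F) / ⟨[a₁], …, [a_{k_r}]⟩}_{r > 0}`, with the natural quotient maps. -/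
def quotientPersistence (F : Type v) [Field F] {X : Type w} [MetricSpace X] {n : ℕ}
    (a : Fin n → Loop X) : Persistence.{v, w} F :=
  quotientsOf.{v, w} F (H1.{v, w} F X) ⟨shortSpan F a, fun _ _ h => shortSpan_mono F a h⟩

/-- An isomorphism from the quotient persistence to the Rips persistence is induced by samples if it
sends the class of each loop `α` to the class of each `r`-sample of `α`, for all `r > 0`. -/
def IsInducedBySamples {F : Type v} [Field F] {X : Type w} [MetricSpace X] {n : ℕ}
    {a : Fin n → Loop X} (φ : quotientPersistence.{v, w} F a ≅ ripsPersistence.{v, w} F X) : Prop :=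
  ∀ (r : Set.Ioi (0 : ℝ)) (α : Loop X) (L : RLoop X r), L.IsSampleOf α →
    (φ.hom.app r).hom ((shortSpan F a r).mkQ (α.homologyClass F)) = L.homologyClass F

end

end GeodesicPersistence

open GeodesicPersistence

namespace GeodesicPersistence

noncomputable section

/-! The theorem reduces to one computation: for every `r`, sampling induces an isomorphism from
`H₁(X; F) / W_r` to `H₁(Rips(X, r); F)`, where `W_r` (`shortLoopSpan`) is spanned by all loops of
length `< 3r`.

All chain arguments take place in `1`-chains modulo boundaries. A linear map out of this space is a
function on edges that is additive on `2`-simplices, and `H₁` sits in it as the kernel of the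
boundary. A path `γ` is sampled by integrating the edge classes of the Rips complex along it: near
the diagonal `ripsClass (γ s) (γ t)` is a difference `φ t - φ s`, and the sample is `φ 1 - φ 0`.
Sampling is onto because a geodesic of length `< r` samples to the corresponding edge
(`sampleHom_surjective`). Loops of length `< 3r` die because cutting one into thirds gives a face of
the Rips complex (`sampleHom_homologyClass_of_length_lt`). Nothing else dies: filling edges by
geodesics inverts sampling modulo geodesic triangles, whose perimeter is `< 3r`, and semi-local
simple connectedness identifies short pieces of paths with geodesics (`ker_sampleHom_le`).

The rest is linear algebra. If `a` is lexicographically minimal, a Steinitz exchange shows that the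
`a i` with `l_i < 3r` already span `W_r` (`IsLexMinBase.shortSpan_eq_shortLoopSpan`), so the
quotient persistence is the Rips persistence and splits into bars along the base. Conversely, the
two isomorphisms give `dim W_r` as the number of `i` with `l_i < 3r`, and no base can have more
loops of length `< 3r` than that; that `a` generates follows from the vanishing of `H₁(Rips(X, r);
F)` for large `r`. Critical values are the places where the quotient changes. -/

/-! ### One-chains modulo boundaries -/

section OneChains

variable (F : Type v) [Field F] (S : SSet.{w})

/-- The morphism out of the `n`-chains with prescribed values on the simplices. -/
def chainDesc {n : ℕ} {M : Type (max v w)} [AddCommGroup M] [Module F M] (f : S _⦋n⦌ → M) :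
    (S.chainComplex (coeff.{v, w} F)).X n ⟶ ModuleCat.of F M :=
  (S.isColimitChainComplexXCofan (coeff.{v, w} F) n).desc
    (Cofan.mk (ModuleCat.of F M) fun x => ModuleCat.ofHom
      ((LinearMap.toSpanSingleton F M (f x)).comp ULift.moduleEquiv.toLinearMap))

theorem ιChainComplex_chainDesc {n : ℕ} {M : Type (max v w)} [AddCommGroup M] [Module F M]
    (f : S _⦋n⦌ → M) (x : S _⦋n⦌) :
    S.ιChainComplex x ≫ chainDesc F S f = ModuleCat.ofHom
      ((LinearMap.toSpanSingleton F M (f x)).comp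
        (ULift.moduleEquiv : ULift.{w} F ≃ₗ[F] F).toLinearMap) :=
  (S.isColimitChainComplexXCofan (coeff.{v, w} F) n).fac _ ⟨x⟩

theorem coeff_hom_ext {M : ModuleCat.{max v w} F} {f g : coeff.{v, w} F ⟶ M}
    (h : f.hom (ULift.up 1) = g.hom (ULift.up 1)) : f = g := by
  refine ModuleCat.hom_ext (LinearMap.ext fun x => ?_)
  have hx : x = x.down • (ULift.up 1 : ULift.{w} F) := ULift.ext _ _ (by simp)
  rw [hx, map_smul, map_smul, h]

/-- The space of `1`-chains of `S` modulo boundaries. -/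
abbrev ChainsModBoundaries : Type (max v w) :=
  ((S.chainComplex (coeff.{v, w} F)).opcycles 1 : ModuleCat.{max v w} F)

variable {S}

/-- The class of an edge in the space of `1`-chains modulo boundaries. -/
def edgeClass (e : S _⦋1⦌) : ChainsModBoundaries.{v, w} F S :=
  (S.ιChainComplex (R := coeff.{v, w} F) e ≫
    (S.chainComplex (coeff.{v, w} F)).pOpcycles 1).hom (ULift.up 1)

variable {F} in
/-- An additive function on edges extends to the `1`-chains modulo boundaries. -/
def edgeLift {M : Type (max v w)} [AddCommGroup M] [Module F M] (f : S _⦋1⦌ → M)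
    (hf : ∀ s : S _⦋2⦌, f (S.δ 0 s) + f (S.δ 2 s) = f (S.δ 1 s)) :
    ChainsModBoundaries.{v, w} F S →ₗ[F] M :=
  ((S.chainComplex (coeff.{v, w} F)).descOpcycles (chainDesc F S f) 2 (by simp) (by
    refine SSet.chainComplex_hom_ext fun s => ?_
    rw [S.ιChainComplex_d_assoc (R := coeff.{v, w} F) (n := 1) s, Fin.sum_univ_three]
    simp only [Preadditive.add_comp, Preadditive.zsmul_comp, ιChainComplex_chainDesc]
    refine coeff_hom_ext F ?_
    simp [ModuleCat.hom_zero, ← hf s, ModuleCat.hom_add, ModuleCat.hom_neg])).hom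

variable {F} in
@[simp]
theorem edgeLift_edgeClass {M : Type (max v w)} [AddCommGroup M] [Module F M] (f : S _⦋1⦌ → M)
    (hf : ∀ s : S _⦋2⦌, f (S.δ 0 s) + f (S.δ 2 s) = f (S.δ 1 s)) (e : S _⦋1⦌) :
    edgeLift f hf (edgeClass.{v, w} F e) = f e := by
  rw [edgeLift, edgeClass, ← LinearMap.comp_apply, ← ModuleCat.hom_comp, Category.assoc,
    HomologicalComplex.p_descOpcycles, ιChainComplex_chainDesc]
  simp

variable {F} in
theorem chainsModBoundaries_ext {M : Type (max v w)} [AddCommGroup M] [Module F M]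
    {f g : ChainsModBoundaries.{v, w} F S →ₗ[F] M}
    (h : ∀ e : S _⦋1⦌, f (edgeClass F e) = g (edgeClass F e)) : f = g := by
  suffices ModuleCat.ofHom f = ModuleCat.ofHom g from congrArg ModuleCat.Hom.hom this
  rw [← cancel_epi ((S.chainComplex (coeff.{v, w} F)).pOpcycles 1)]
  refine SSet.chainComplex_hom_ext fun e => coeff_hom_ext F ?_
  exact h e

/-- The alternating sum of the faces is a boundary. With `edgeLift`, this presents the space by
generators (edges) and relations (`2`-simplices). -/
theorem edgeClass_add (s : S _⦋2⦌) :
    edgeClass.{v, w} F (S.δ 0 s) + edgeClass F (S.δ 2 s) = edgeClass F (S.δ 1 s) := by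
  have h := S.ιChainComplex_d (R := coeff.{v, w} F) (n := 1) s
  rw [Fin.sum_univ_three] at h
  have h2 := congrArg (· ≫ (S.chainComplex (coeff.{v, w} F)).pOpcycles 1) h
  simp only [Category.assoc, HomologicalComplex.d_pOpcycles, comp_zero, Preadditive.add_comp,
    Preadditive.zsmul_comp] at h2
  have h3 := congrArg (fun f => f.hom (ULift.up (1 : F))) h2
  simp [ModuleCat.hom_zero, ModuleCat.hom_add, ModuleCat.hom_neg] at h3
  simp only [edgeClass, ModuleCat.hom_comp, LinearMap.comp_apply]
  rw [← sub_eq_zero]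
  exact Eq.trans (by abel) h3.symm

theorem span_edgeClass :
    Submodule.span F (Set.range fun e : S _⦋1⦌ => edgeClass.{v, w} F e) = ⊤ := by
  rw [← Submodule.ker_mkQ (Submodule.span F _), LinearMap.ker_eq_top]
  refine chainsModBoundaries_ext fun e => ?_
  simpa using Submodule.subset_span (Set.mem_range_self e)

variable (S) in
/-- The boundary of `1`-chains modulo boundaries. -/
def edgeBoundary : ChainsModBoundaries.{v, w} F S →ₗ[F] (S _⦋0⦌ →₀ F) :=
  edgeLift (fun e => Finsupp.single (S.δ 0 e) 1 - Finsupp.single (S.δ 1 e) 1) fun s => by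
    have h01 : S.δ 0 (S.δ 1 s) = S.δ 0 (S.δ 0 s) := (S.δ_comp_δ_apply (i := 0) (j := 0) le_rfl s)
    have h02 : S.δ 0 (S.δ 2 s) = S.δ 1 (S.δ 0 s) := (S.δ_comp_δ_apply (i := 0) (j := 1) (by simp) s)
    have h12 : S.δ 1 (S.δ 2 s) = S.δ 1 (S.δ 1 s) := (S.δ_comp_δ_apply (i := 1) (j := 1) (by simp) s)
    rw [h01, h02, h12]
    abel

@[simp]
theorem edgeBoundary_edgeClass (e : S _⦋1⦌) : edgeBoundary F S (edgeClass F e) =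
    Finsupp.single (S.δ 0 e) 1 - Finsupp.single (S.δ 1 e) 1 :=
  edgeLift_edgeClass _ _ e

variable (S) in
/-- The inclusion of the first homology into the `1`-chains modulo boundaries. -/
def homologyIncl : (S.homology (coeff.{v, w} F) 1 : ModuleCat.{max v w} F) →ₗ[F]
    ChainsModBoundaries.{v, w} F S :=
  ((S.chainComplex (coeff.{v, w} F)).homologyι 1).hom

theorem homologyIncl_injective : Function.Injective (homologyIncl.{v, w} F S) :=
  (ModuleCat.mono_iff_injective ((S.chainComplex (coeff.{v, w} F)).homologyι 1)).1 inferInstance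

theorem homologyIncl_edgeCycleClass {m : ℕ} (e : Fin (m + 1) → S _⦋1⦌) (he : IsEdgeCycle S e) :
    homologyIncl F S (edgeCycleClass.{v, w} F S e he) = ∑ i, edgeClass F (e i) := by
  simp only [homologyIncl, edgeCycleClass, edgeClass]
  rw [← LinearMap.comp_apply, ← ModuleCat.hom_comp, Category.assoc,
    HomologicalComplex.homology_π_ι, HomologicalComplex.liftCycles_i_assoc, edgeChain,
    Preadditive.sum_comp, ModuleCat.hom_sum, LinearMap.sum_apply]

/-- Compares the explicit boundary with the differential of the complex, the two differing by taking
coordinates of `0`-chains. -/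
theorem edgeBoundary_eq_comp : edgeBoundary F S =
    (chainDesc F S fun x => Finsupp.single x (1 : F)).hom.comp
      ((S.chainComplex (coeff.{v, w} F)).fromOpcycles 1 0).hom := by
  refine chainsModBoundaries_ext fun e => ?_
  have h := S.ιChainComplex_d (R := coeff.{v, w} F) (n := 0) e
  have h2 : edgeClass F e = (S.ιChainComplex (R := coeff.{v, w} F) e ≫
    (S.chainComplex (coeff.{v, w} F)).pOpcycles 1).hom (ULift.up 1) := rfl
  rw [edgeBoundary_edgeClass, h2, ← LinearMap.comp_apply, LinearMap.comp_assoc,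
    ← ModuleCat.hom_comp, ← ModuleCat.hom_comp, Category.assoc, Category.assoc,
    HomologicalComplex.p_fromOpcycles_assoc, reassoc_of% h, Fin.sum_univ_two]
  simp only [Preadditive.add_comp, Preadditive.zsmul_comp, ιChainComplex_chainDesc]
  simp [ModuleCat.hom_add, ModuleCat.hom_neg, sub_eq_add_neg]

/-- Homology is the kernel of the map from opcycles to `0`-chains, and taking coordinates of
`0`-chains loses nothing. -/
theorem range_homologyIncl :
    LinearMap.range (homologyIncl.{v, w} F S) = LinearMap.ker (edgeBoundary.{v, w} F S) := by
  have hinj : Function.Injective (chainDesc F S fun x : S _⦋0⦌ => Finsupp.single x (1 : F)).hom := by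
    -- Left inverse of the coordinate map: a formal combination of vertices is reassembled into a
    -- `0`-chain.
    let g : (S _⦋0⦌ →₀ F) →ₗ[F] ((S.chainComplex (coeff.{v, w} F)).X 0 : ModuleCat.{max v w} F) :=
      Finsupp.lift _ F _ fun x => (S.ιChainComplex (R := coeff.{v, w} F) x).hom (ULift.up 1)
    have hg : chainDesc F S (fun x : S _⦋0⦌ => Finsupp.single x (1 : F)) ≫ ModuleCat.ofHom g =
        𝟙 _ := by
      refine SSet.chainComplex_hom_ext fun x => coeff_hom_ext F ?_
      rw [reassoc_of% ιChainComplex_chainDesc]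
      simp [g]
    exact Function.LeftInverse.injective (g := g) fun x =>
      congrArg (fun f => ModuleCat.Hom.hom f x) hg
  rw [edgeBoundary_eq_comp, LinearMap.ker_comp_of_ker_eq_bot _ (LinearMap.ker_eq_bot.2 hinj)]
  have hex : (ShortComplex.mk ((S.chainComplex (coeff.{v, w} F)).homologyι 1)
      ((S.chainComplex (coeff.{v, w} F)).fromOpcycles 1 0)
      (HomologicalComplex.homologyι_comp_fromOpcycles _ _ _)).Exact :=
    ShortComplex.exact_of_f_is_kernel _
      ((S.chainComplex (coeff.{v, w} F)).homologyIsKernel 1 0 (by simp))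
  exact hex.moduleCat_range_eq_ker

variable {T : SSet.{w}}

/-- The map of `1`-chains modulo boundaries induced by a map of simplicial sets. -/
def edgeMap (f : S ⟶ T) :
    ChainsModBoundaries.{v, w} F S →ₗ[F] ChainsModBoundaries.{v, w} F T :=
  (HomologicalComplex.opcyclesMap (SSet.chainComplexMap f (coeff.{v, w} F)) 1).hom

@[simp]
theorem edgeMap_edgeClass (f : S ⟶ T) (e : S _⦋1⦌) :
    edgeMap F f (edgeClass F e) = edgeClass F (f.app _ e) := by
  simp only [edgeMap, edgeClass]
  rw [← LinearMap.comp_apply, ← ModuleCat.hom_comp, Category.assoc,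
    HomologicalComplex.p_opcyclesMap, SSet.ι_chainComplexMap_f_assoc]

theorem homologyIncl_homologyMap (f : S ⟶ T)
    (x : (S.homology (coeff.{v, w} F) 1 : ModuleCat.{max v w} F)) :
    homologyIncl F T ((SSet.homologyMap f (coeff.{v, w} F) 1).hom x) =
      edgeMap F f (homologyIncl F S x) := by
  simp only [homologyIncl, edgeMap]
  rw [← LinearMap.comp_apply, ← ModuleCat.hom_comp, HomologicalComplex.homologyι_naturality]
  rfl

end OneChains

/-! ### Faces of standard simplices -/

theorem stdSimplex_map_succAbove_apply {n : ℕ} (i : Fin (n + 2)) (x : stdSimplex ℝ (Fin (n + 1)))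
    (j : Fin (n + 1)) : stdSimplex.map i.succAbove x (i.succAbove j) = x j := by
  simp [stdSimplex.map_coe, FunOnFinite.linearMap_apply_apply, Finset.filter_eq']

theorem stdSimplex_map_succAbove_self {n : ℕ} (i : Fin (n + 2)) (x : stdSimplex ℝ (Fin (n + 1))) :
    stdSimplex.map i.succAbove x i = 0 := by
  simp [stdSimplex.map_coe, FunOnFinite.linearMap_apply_apply, Fin.succAbove_ne]

/-! ### Paths as singular edges -/

section Paths

variable (F : Type v) [Field F] {X : Type w} [TopologicalSpace X]

/-- The singular simplicial set of `X`. -/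
abbrev Sing (X : Type w) [TopologicalSpace X] : SSet.{w} := TopCat.toSSet.obj (TopCat.of X)

/-- A continuous map from the unit interval, as a singular edge. -/
def pathEdge (γ : C(unitInterval, X)) : (Sing X) _⦋1⦌ :=
  ((TopCat.of X).toSSetObjEquiv (.op ⦋1⦌)).symm
    (γ.comp (stdSimplexHomeomorphUnitInterval : C(stdSimplex ℝ (Fin 2), _)))

/-- A singular edge, as a continuous map from the unit interval. -/
def edgePath (e : (Sing X) _⦋1⦌) : C(unitInterval, X) :=
  ((TopCat.of X).toSSetObjEquiv (.op ⦋1⦌) e).comp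
    (stdSimplexHomeomorphUnitInterval.symm : C(unitInterval, stdSimplex ℝ (Fin 2)))

@[simp]
theorem edgePath_pathEdge (γ : C(unitInterval, X)) : edgePath (pathEdge γ) = γ := by
  ext t
  simp [edgePath, pathEdge]

@[simp]
theorem pathEdge_edgePath (e : (Sing X) _⦋1⦌) : pathEdge (edgePath e) = e := by
  refine ((TopCat.of X).toSSetObjEquiv (.op ⦋1⦌)).injective ?_
  ext t
  simp [edgePath, pathEdge]

/-- A point of `X` as a singular vertex. -/
def pointVertex (x : X) : (Sing X) _⦋0⦌ :=
  ((TopCat.of X).toSSetObjEquiv (.op ⦋0⦌)).symm (ContinuousMap.const _ x)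

theorem δ_pathEdge (γ : C(unitInterval, X)) (k : Fin 2) :
    (Sing X).δ k (pathEdge γ) = pointVertex (γ (if k = 0 then 1 else 0)) := by
  apply ((TopCat.of X).toSSetObjEquiv (.op ⦋0⦌)).injective
  ext x
  change γ (stdSimplexHomeomorphUnitInterval
      (stdSimplex.map (SimplexCategory.δ k).toOrderHom x)) = _
  have hx : x = stdSimplex.vertex 0 := Subsingleton.elim (α := stdSimplex ℝ (Fin 1)) _ _
  rw [hx, stdSimplex.map_vertex]
  fin_cases k
  · exact congrArg γ stdSimplexHomeomorphUnitInterval_one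
  · exact congrArg γ stdSimplexHomeomorphUnitInterval_zero

/-- The class of a path modulo boundaries of singular `2`-simplices. -/
def pathClass (γ : C(unitInterval, X)) : ChainsModBoundaries.{v, w} F (Sing X) :=
  edgeClass F (pathEdge γ)

variable (X) in
/-- The inclusion of `H₁(X; F)` into the singular `1`-chains modulo boundaries. -/
def singIncl : H1.{v, w} F X →ₗ[F] ChainsModBoundaries.{v, w} F (Sing X) :=
  homologyIncl F (Sing X)

theorem singIncl_injective : Function.Injective (singIncl.{v, w} F X) :=
  homologyIncl_injective F

theorem range_singIncl :
    LinearMap.range (singIncl.{v, w} F X) = LinearMap.ker (edgeBoundary.{v, w} F (Sing X)) :=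
  range_homologyIncl F

theorem singIncl_homologyClass (α : Loop X) :
    singIncl F X (α.homologyClass F) = pathClass F α.path.toContinuousMap :=
  (homologyIncl_edgeCycleClass F _ α.isEdgeCycle).trans (Fin.sum_univ_one _)

theorem edgeBoundary_pathClass (γ : C(unitInterval, X)) :
    edgeBoundary F (Sing X) (pathClass F γ) =
      Finsupp.single (pointVertex (γ 1)) 1 - Finsupp.single (pointVertex (γ 0)) 1 := by
  simp [pathClass, δ_pathEdge]

/-- The point dividing the segment from `s` to `t` in the ratio `u : 1 - u`. -/
def segPoint (s t u : unitInterval) : unitInterval :=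
  ⟨(1 - u) * s + u * t, convex_Icc (0 : ℝ) 1 s.2 t.2 (sub_nonneg.2 u.2.2) u.2.1 (by ring)⟩

/-- The restriction of a path to the segment from `s` to `t`. -/
def segPath (γ : C(unitInterval, X)) (s t : unitInterval) : Path (γ s) (γ t) where
  toFun u := γ (segPoint s t u)
  continuous_toFun := γ.continuous.comp (Continuous.subtype_mk (by fun_prop) _)
  source' := congrArg γ (Subtype.ext (by simp [segPoint]))
  target' := congrArg γ (Subtype.ext (by simp [segPoint]))

/-- The class of the restriction of a path to the segment from `s` to `t`. -/
def segClass (γ : C(unitInterval, X)) (s t : unitInterval) :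
    ChainsModBoundaries.{v, w} F (Sing X) :=
  pathClass F (segPath γ s t).toContinuousMap

/-- The affine triangle with vertices `s`, `t`, `u` in the interval, composed with `γ`, has the
three segments as its faces. No order on `s`, `t`, `u` is assumed, so constant, reversed and
concatenated paths are all handled by this one relation. -/
theorem segClass_add (γ : C(unitInterval, X)) (s t u : unitInterval) :
    segClass F γ s t + segClass F γ t u = segClass F γ s u := by
  let p : stdSimplex ℝ (Fin 3) → unitInterval := fun z => ⟨z 0 * s + z 1 * t + z 2 * u, by
    have h0 := z.2.1
    have := (convex_Icc (0 : ℝ) 1).sum_mem (t := Finset.univ) (w := z.1)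
      (z := ![(s : ℝ), (t : ℝ), (u : ℝ)]) (fun i _ => h0 i) z.2.2 (by
        intro i _
        fin_cases i <;> [exact s.2; exact t.2; exact u.2])
    rw [Fin.sum_univ_three] at this
    exact this⟩
  have hp : Continuous p := Continuous.subtype_mk (by
    have : ∀ i : Fin 3, Continuous fun z : stdSimplex ℝ (Fin 3) => z i :=
      fun i => (continuous_apply i).comp continuous_subtype_val
    exact (((this 0).mul continuous_const).add ((this 1).mul continuous_const)).add
      ((this 2).mul continuous_const)) _
  let τ : (Sing X) _⦋2⦌ := ((TopCat.of X).toSSetObjEquiv (.op ⦋2⦌)).symm (γ.comp ⟨p, hp⟩)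
  -- Faces and segments are both parametrized affinely, so it is enough to compare their parameters;
  -- no reparametrization is involved.
  have key : ∀ (k : Fin 3) (a b : unitInterval),
      (∀ x : stdSimplex ℝ (Fin 2), (p (stdSimplex.map k.succAbove x) : ℝ) = x 0 * a + x 1 * b) →
      edgeClass F ((Sing X).δ k τ) = segClass F γ a b := by
    intro k a b h
    refine congrArg (edgeClass F) (((TopCat.of X).toSSetObjEquiv (.op ⦋1⦌)).injective ?_)
    ext x
    change γ (p (stdSimplex.map k.succAbove x)) =
      γ (segPoint a b (stdSimplexHomeomorphUnitInterval x))
    refine congrArg γ (Subtype.ext ((h x).trans ?_))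
    have hx : x 0 + x 1 = 1 :=
      (Fin.sum_univ_two fun i : Fin 2 => (x : Fin 2 → ℝ) i).symm.trans x.2.2
    change x 0 * (a : ℝ) + x 1 * b = (1 - x 1) * a + x 1 * b
    rw [← hx]
    ring
  have h := edgeClass_add F τ
  have e : ∀ (k : Fin 3) (x : stdSimplex ℝ (Fin 2)), stdSimplex.map k.succAbove x k = 0 :=
    fun k x => stdSimplex_map_succAbove_self k x
  have e0 : ∀ (k : Fin 3) (x : stdSimplex ℝ (Fin 2)),
      stdSimplex.map k.succAbove x (k.succAbove 0) = x 0 :=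
    fun k x => stdSimplex_map_succAbove_apply k x 0
  have e1 : ∀ (k : Fin 3) (x : stdSimplex ℝ (Fin 2)),
      stdSimplex.map k.succAbove x (k.succAbove 1) = x 1 :=
    fun k x => stdSimplex_map_succAbove_apply k x 1
  rw [key 0 t u fun x => ?_, key 2 s t fun x => ?_, key 1 s u fun x => ?_, add_comm] at h
  · exact h
  · have hz := e 1 x; have h0 := e0 1 x; have h1 := e1 1 x
    change stdSimplex.map (Fin.succAbove 1) x 0 = _ at h0
    change stdSimplex.map (Fin.succAbove 1) x 2 = _ at h1
    change stdSimplex.map (Fin.succAbove 1) x 0 * (s : ℝ) +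
      stdSimplex.map (Fin.succAbove 1) x 1 * t + stdSimplex.map (Fin.succAbove 1) x 2 * u = _
    rw [hz, h0, h1]
    ring
  · have hz := e 2 x; have h0 := e0 2 x; have h1 := e1 2 x
    change stdSimplex.map (Fin.succAbove 2) x 0 = _ at h0
    change stdSimplex.map (Fin.succAbove 2) x 1 = _ at h1
    change stdSimplex.map (Fin.succAbove 2) x 0 * (s : ℝ) +
      stdSimplex.map (Fin.succAbove 2) x 1 * t + stdSimplex.map (Fin.succAbove 2) x 2 * u = _
    rw [hz, h0, h1]
    ring
  · have hz := e 0 x; have h0 := e0 0 x; have h1 := e1 0 x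
    change stdSimplex.map (Fin.succAbove 0) x 1 = _ at h0
    change stdSimplex.map (Fin.succAbove 0) x 2 = _ at h1
    change stdSimplex.map (Fin.succAbove 0) x 0 * (s : ℝ) +
      stdSimplex.map (Fin.succAbove 0) x 1 * t + stdSimplex.map (Fin.succAbove 0) x 2 * u = _
    rw [hz, h0, h1]
    ring

theorem segClass_self (γ : C(unitInterval, X)) (s : unitInterval) : segClass F γ s s = 0 := by
  simpa using segClass_add F γ s s s

theorem segClass_zero_one (γ : C(unitInterval, X)) : segClass F γ 0 1 = pathClass F γ := by
  refine congrArg (pathClass F) (ContinuousMap.ext fun t => congrArg γ (Subtype.ext ?_))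
  simp [segPoint]

theorem pathClass_const (x : X) : pathClass F (ContinuousMap.const unitInterval x) = 0 := by
  rw [← segClass_zero_one, ← segClass_self F (ContinuousMap.const unitInterval x) 0]
  rfl

theorem pathClass_symm {x y : X} (p : Path x y) :
    pathClass F p.symm.toContinuousMap = -pathClass F p.toContinuousMap := by
  -- A reversed path is the segment traversed from `1` to `0`.
  have h : pathClass F p.symm.toContinuousMap = segClass F p.toContinuousMap 1 0 := by
    refine congrArg (pathClass F) (ContinuousMap.ext fun t => congrArg p (Subtype.ext ?_))
    simp [segPoint]
  rw [h, ← segClass_zero_one, eq_neg_iff_add_eq_zero, segClass_add, segClass_self]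

/-- The two halves of `p.trans q`, rescaled affinely to the unit interval, are exactly `p` and `q`.
-/
theorem pathClass_trans {x y z : X} (p : Path x y) (q : Path y z) :
    pathClass F (p.trans q).toContinuousMap =
      pathClass F p.toContinuousMap + pathClass F q.toContinuousMap := by
  let h : unitInterval := ⟨1 / 2, by norm_num, by norm_num⟩
  rw [← segClass_zero_one, ← segClass_add F _ 0 h 1]
  congr 1
  · refine congrArg (pathClass F) (ContinuousMap.ext fun t => ?_)
    change p.trans q (segPoint 0 h t) = p t
    have ht : ((segPoint 0 h t : unitInterval) : ℝ) = t / 2 := by simp [segPoint, h]; ring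
    have := t.2.2
    rw [Path.trans_apply, dif_pos (by rw [ht]; linarith)]
    exact congrArg p (Subtype.ext (by simp only [ht]; ring))
  · refine congrArg (pathClass F) (ContinuousMap.ext fun t => ?_)
    change p.trans q (segPoint h 1 t) = q t
    have ht : ((segPoint h 1 t : unitInterval) : ℝ) = 1 / 2 + t / 2 := by simp [segPoint, h]; ring
    -- At the midpoint `Path.trans` is evaluated by its first branch, so the start of `q` needs
    -- separate treatment.
    by_cases h0 : (t : ℝ) = 0
    · obtain rfl : t = 0 := Subtype.ext h0
      rw [Path.trans_apply, dif_pos (by rw [ht]; simp)]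
      refine Eq.trans ?_ (p.target.trans q.source.symm)
      exact congrArg p (Subtype.ext (by simp [ht]))
    · have := lt_of_le_of_ne t.2.1 (Ne.symm h0)
      rw [Path.trans_apply, dif_neg (by rw [ht]; linarith)]
      exact congrArg q (Subtype.ext (by simp only [ht]; ring))

end Paths

/-! ### Small loops -/

section SmallLoops

variable (F : Type v) [Field F]

theorem singIncl_H1Incl {X : Type w} [TopologicalSpace X] (U : Set X) (x : H1.{v, w} F U) :
    singIncl F X ((H1Incl F X U).hom x) =
      edgeMap F (TopCat.toSSet.map (TopCat.ofHom ⟨Subtype.val, continuous_subtype_val⟩))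
        (singIncl F U x) :=
  homologyIncl_homologyMap F
    (TopCat.toSSet.map (TopCat.ofHom (⟨Subtype.val, continuous_subtype_val⟩ : C(U, X)))) x

theorem homologyClass_eq_zero_of_range_subset {X : Type w} [TopologicalSpace X] {U : Set X}
    (hU : H1Incl.{v, w} F X U = 0) (α : Loop X) (hα : ∀ t, α.path t ∈ U) :
    α.homologyClass F = 0 := by
  let β : Loop U :=
    { base := ⟨α.base, by simpa using hα 0⟩
      path :=
        { toFun := fun t => ⟨α.path t, hα t⟩
          continuous_toFun := α.path.continuous.subtype_mk _
          source' := Subtype.ext α.path.source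
          target' := Subtype.ext α.path.target } }
  have h := singIncl_H1Incl F U (β.homologyClass F)
  rw [hU, singIncl_homologyClass, pathClass, edgeMap_edgeClass] at h
  refine singIncl_injective F ((singIncl_homologyClass F α).trans (Eq.trans ?_ h.symm))
  rfl

/-- A Lebesgue number for the interiors of the neighbourhoods in `IsSLSC` makes the condition
uniform. -/
theorem exists_forall_homologyClass_eq_zero {X : Type w} [MetricSpace X] [CompactSpace X]
    (h : IsSLSC.{v, w} F X) :
    ∃ δ > 0, ∀ (α : Loop X) (x : X), (∀ t, dist (α.path t) x < δ) → α.homologyClass F = 0 := by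
  choose U hU hU0 using h.2
  obtain ⟨δ, hδ, hball⟩ := lebesgue_number_lemma_of_metric (s := Set.univ) isCompact_univ
    (c := fun x => interior (U x)) (fun x => isOpen_interior)
    (fun x _ => Set.mem_iUnion.2 ⟨x, mem_interior_iff_mem_nhds.2 (hU x)⟩)
  refine ⟨δ, hδ, fun α x hα => ?_⟩
  obtain ⟨y, hy⟩ := hball x trivial
  exact homologyClass_eq_zero_of_range_subset F (hU0 y) α fun t => interior_subset (hy (hα t))

/-- Such a loop is constant. This keeps the lengths in a base positive, so that `l_i / 3` is an
admissible parameter. -/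
theorem homologyClass_eq_zero_of_length_eq_zero {X : Type w} [MetricSpace X] (α : Loop X)
    (h : α.length = 0) : α.homologyClass F = 0 := by
  refine singIncl_injective F ?_
  rw [singIncl_homologyClass, map_zero, ← pathClass_const F α.base]
  refine congrArg (pathClass F) (ContinuousMap.ext fun t => ?_)
  have := (eVariationOn.eq_zero_iff _).1 h t trivial 0 trivial
  simpa using this

end SmallLoops

/-! ### Lengths of paths and geodesics -/

section Lengths

variable {X : Type w} [MetricSpace X]

/-- Variation is additive over the two halves of the interval, and each half is a monotone
reparametrization of `p` or `q`. The reparametrizations are clamped by `projIcc` so that they are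
defined and monotone on the whole interval. -/
theorem eVariationOn_trans_le {x y z : X} (p : Path x y) (q : Path y z) :
    eVariationOn (p.trans q) Set.univ ≤ eVariationOn p Set.univ + eVariationOn q Set.univ := by
  let h : unitInterval := ⟨1 / 2, by norm_num, by norm_num⟩
  rw [show eVariationOn (p.trans q) Set.univ = _ from
    (congrArg _ (Set.Iic_union_Ici (a := h)).symm).trans
      (eVariationOn.union _ isGreatest_Iic isLeast_Ici)]
  refine add_le_add ?_ ?_
  · refine (eVariationOn.congr (g := p ∘ fun t : unitInterval =>
      Set.projIcc (0 : ℝ) 1 zero_le_one (2 * t)) ?_).trans_le ?_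
    rotate_left
    · refine eVariationOn.comp_le_of_monotoneOn _ _ (Monotone.monotoneOn ?_ _)
        fun _ _ => Set.mem_univ _
      exact fun s t hst => Set.monotone_projIcc _
        (mul_le_mul_of_nonneg_left (Subtype.coe_le_coe.2 hst) zero_le_two)
    · intro t ht
      have ht' : (t : ℝ) ≤ 1 / 2 := ht
      rw [Path.trans_apply, dif_pos ht']
      refine congrArg p (Set.projIcc_of_mem _ _).symm
  · refine (eVariationOn.congr (g := q ∘ fun t : unitInterval =>
      Set.projIcc (0 : ℝ) 1 zero_le_one (2 * t - 1)) ?_).trans_le ?_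
    rotate_left
    · refine eVariationOn.comp_le_of_monotoneOn _ _ (Monotone.monotoneOn ?_ _)
        fun _ _ => Set.mem_univ _
      exact fun s t hst => Set.monotone_projIcc _ (sub_le_sub_right
        (mul_le_mul_of_nonneg_left (Subtype.coe_le_coe.2 hst) zero_le_two) _)
    · intro t ht
      have ht' : 1 / 2 ≤ (t : ℝ) := ht
      rw [Path.trans_apply]
      split_ifs with h2
      · have : (t : ℝ) = 1 / 2 := le_antisymm h2 ht'
        refine Eq.trans (Eq.trans (congrArg p (Subtype.ext ?_)) p.target)
          (Eq.trans q.source.symm (congrArg q ?_))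
        · simp [this]
        · simp [this]
      · exact congrArg q (Set.projIcc_of_mem _ _).symm

theorem eVariationOn_symm_le {x y : X} (p : Path x y) :
    eVariationOn p.symm Set.univ ≤ eVariationOn p Set.univ :=
  eVariationOn.comp_le_of_antitoneOn p unitInterval.symm
    (fun _ _ _ _ h => sub_le_sub_left (Subtype.coe_le_coe.2 h) _) fun _ _ => Set.mem_univ _

/-- The first bound makes a geodesic of length `< r` sample to a single edge; the second bounds the
perimeter of geodesic triangles. -/
theorem IsGeodesicSpace.exists_path (hX : IsGeodesicSpace X) (x y : X) : ∃ p : Path x y,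
    (∀ s t, dist (p s) (p t) ≤ dist x y) ∧
      eVariationOn p Set.univ ≤ ENNReal.ofReal (dist x y) := by
  obtain ⟨γ, h0, h1, hγ⟩ := hX x y
  have hmem : ∀ t : unitInterval, dist x y * (t : ℝ) ∈ Set.Icc 0 (dist x y) := fun t =>
    ⟨mul_nonneg dist_nonneg t.2.1, mul_le_of_le_one_right dist_nonneg t.2.2⟩
  have hlip : LipschitzOnWith 1 γ (Set.Icc 0 (dist x y)) :=
    LipschitzOnWith.of_dist_le_mul fun s hs t ht => by simp [hγ s hs t ht, Real.dist_eq]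
  refine ⟨{ toFun := fun t => γ (dist x y * t)
            continuous_toFun := hlip.continuousOn.comp_continuous (by fun_prop) hmem
            source' := by simp [h0]
            target' := by simp [h1] }, fun s t => ?_, ?_⟩
  · change dist (γ (dist x y * s)) (γ (dist x y * t)) ≤ _
    rw [hγ _ (hmem s) _ (hmem t), abs_sub_le_iff]
    constructor <;> linarith [(hmem s).1, (hmem s).2, (hmem t).1, (hmem t).2]
  · refine (hlip.comp_eVariationOn_le (g := fun t : unitInterval => dist x y * t)
      (s := Set.univ) fun t _ => hmem t).trans ?_
    have hmono : MonotoneOn (fun t : unitInterval => dist x y * (t : ℝ)) Set.univ :=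
      fun s _ t _ hst => mul_le_mul_of_nonneg_left (Subtype.coe_le_coe.2 hst) dist_nonneg
    have := (hmono.eVariationOn_eq (Set.mem_univ 0) (Set.mem_univ 1)).le
    rw [show Set.univ ∩ Set.Icc (0 : unitInterval) 1 = Set.univ from by
      ext t; simp [unitInterval.le_one']] at this
    simpa using this

/-- A chosen geodesic between two points. -/
def geodesic (hX : IsGeodesicSpace X) (x y : X) : Path x y := (hX.exists_path x y).choose

theorem dist_geodesic_le (hX : IsGeodesicSpace X) (x y : X) (s t : unitInterval) :
    dist (geodesic hX x y s) (geodesic hX x y t) ≤ dist x y :=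
  (hX.exists_path x y).choose_spec.1 s t

theorem eVariationOn_geodesic_le (hX : IsGeodesicSpace X) (x y : X) :
    eVariationOn (geodesic hX x y) Set.univ ≤ ENNReal.ofReal (dist x y) :=
  (hX.exists_path x y).choose_spec.2

variable (F : Type v) [Field F]

/-- The class of the chosen geodesic between two points. -/
def geodesicClass (hX : IsGeodesicSpace X) (x y : X) : ChainsModBoundaries.{v, w} F (Sing X) :=
  pathClass F (geodesic hX x y).toContinuousMap

/-- The subspace of `H₁(X; F)` spanned by the loops of length less than `3 r`. -/
def shortLoopSpan (X : Type w) [MetricSpace X] (r : ℝ) : Submodule F (H1.{v, w} F X) :=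
  Submodule.span F ((fun α : Loop X => α.homologyClass F) ''
    {α | α.length < ENNReal.ofReal (3 * r)})

/-- The defect of additivity is the class of the geodesic triangle, a loop of length at most the sum
of three distances `< r`. This is one source of the constant `3`. -/
theorem geodesicClass_triangle_mem (hX : IsGeodesicSpace X) {r : ℝ} {x y z : X}
    (hxy : dist x y < r) (hyz : dist y z < r) (hxz : dist x z < r) :
    geodesicClass F hX y z + geodesicClass F hX x y - geodesicClass F hX x z ∈
      (shortLoopSpan.{v, w} F X r).map (singIncl F X) := by
  let α : Loop X :=
    ⟨x, ((geodesic hX x y).trans (geodesic hX y z)).trans (geodesic hX x z).symm⟩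
  refine ⟨α.homologyClass F, Submodule.subset_span ⟨α, ?_, rfl⟩, ?_⟩
  · have h1 := (eVariationOn_trans_le ((geodesic hX x y).trans (geodesic hX y z))
      (geodesic hX x z).symm).trans (add_le_add
        ((eVariationOn_trans_le _ _).trans (add_le_add (eVariationOn_geodesic_le hX x y)
          (eVariationOn_geodesic_le hX y z)))
        ((eVariationOn_symm_le _).trans (eVariationOn_geodesic_le hX x z)))
    refine h1.trans_lt ?_
    rw [← ENNReal.ofReal_add dist_nonneg dist_nonneg,
      ← ENNReal.ofReal_add (add_nonneg dist_nonneg dist_nonneg) dist_nonneg,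
      ENNReal.ofReal_lt_ofReal_iff_of_nonneg (by positivity)]
    linarith
  · rw [singIncl_homologyClass]
    simp only [α]
    rw [pathClass_trans, pathClass_trans, pathClass_symm]
    simp only [geodesicClass]
    abel

-- A short piece of `γ` followed by the reversed geodesic is a loop in a small ball around its
-- starting point, hence null-homologous.
open scoped Uniformity in
theorem eventually_segClass_eq_geodesicClass [CompactSpace X] (hX : IsGeodesicSpace X)
    (h : IsSLSC.{v, w} F X) (γ : C(unitInterval, X)) :
    ∀ᶠ p in 𝓤 unitInterval, segClass F γ p.1 p.2 = geodesicClass F hX (γ p.1) (γ p.2) := by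
  obtain ⟨δ, hδ, hloop⟩ := exists_forall_homologyClass_eq_zero F h
  obtain ⟨ε, hε, hγ⟩ := Metric.uniformContinuous_iff.1
    (CompactSpace.uniformContinuous_of_continuous γ.continuous) δ hδ
  refine Filter.mem_of_superset (Metric.dist_mem_uniformity hε) ?_
  rintro ⟨s, t⟩ (hst : dist s t < ε)
  have hseg : ∀ u, dist (segPath γ s t u) (γ s) < δ := fun u => by
    refine hγ (lt_of_le_of_lt ?_ hst)
    rw [Subtype.dist_eq, Subtype.dist_eq, Real.dist_eq, Real.dist_eq]
    have : ((segPoint s t u : unitInterval) : ℝ) - s = u * (t - s) := by simp [segPoint]; ring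
    rw [this, abs_mul, abs_of_nonneg u.2.1, abs_sub_comm]
    exact mul_le_of_le_one_left (abs_nonneg _) u.2.2
  have hgeo : ∀ u, dist (geodesic hX (γ s) (γ t) u) (γ s) < δ := fun u => by
    have := dist_geodesic_le hX (γ s) (γ t) u 0
    rw [Path.source] at this
    exact this.trans_lt (hγ hst)
  have hz := hloop ⟨γ s, (segPath γ s t).trans (geodesic hX (γ s) (γ t)).symm⟩ (γ s) fun u => by
    change dist ((segPath γ s t).trans (geodesic hX (γ s) (γ t)).symm u) (γ s) < δ
    rw [Path.trans_apply]
    split_ifs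
    · exact hseg _
    · exact hgeo _
  have h2 := singIncl_homologyClass F
    ⟨γ s, (segPath γ s t).trans (geodesic hX (γ s) (γ t)).symm⟩
  rw [hz, map_zero, pathClass_trans, pathClass_symm, ← sub_eq_add_neg, eq_comm, sub_eq_zero] at h2
  exact h2

end Lengths

/-! ### Primitives of locally additive functions of two points -/

section Primitives

open scoped Uniformity Topology

variable {D : Type*} [UniformSpace D] {M : Type*} [AddCommGroup M]

/-- `φ` is a primitive of `f` if `f x y = φ y - φ x` for all sufficiently close points `x`, `y`. -/
def IsPrimitive (f : D → D → M) (φ : D → M) : Prop :=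
  ∀ᶠ p in 𝓤 D, f p.1 p.2 = φ p.2 - φ p.1

/-- The difference of two primitives is locally constant. -/
theorem IsPrimitive.sub_eq_sub [PreconnectedSpace D] {f : D → D → M} {φ ψ : D → M}
    (hφ : IsPrimitive f φ) (hψ : IsPrimitive f ψ) (x y : D) : φ y - φ x = ψ y - ψ x := by
  have hloc : IsLocallyConstant fun t => φ t - ψ t := by
    refine (IsLocallyConstant.iff_eventually_eq _).2 fun s => ?_
    have h := UniformSpace.ball_mem_nhds s (hφ.and hψ)
    filter_upwards [h] with t ht
    have := ht.1.symm.trans ht.2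
    rw [sub_eq_sub_iff_add_eq_add] at this ⊢
    rw [this, add_comm]
  have := hloc.apply_eq_of_preconnectedSpace x y
  rw [sub_eq_sub_iff_add_eq_add] at this ⊢
  rw [← this, add_comm]

theorem IsPrimitive.comp {D' : Type*} [UniformSpace D'] {f : D → D → M} {φ : D → M}
    (h : IsPrimitive f φ) {g : D' → D} (hg : UniformContinuous g) :
    IsPrimitive (fun s t => f (g s) (g t)) (φ ∘ g) :=
  hg.eventually h

theorem IsPrimitive.map {N : Type*} [AddCommGroup N] {f : D → D → M} {φ : D → M}
    (h : IsPrimitive f φ) (T : M →+ N) : IsPrimitive (fun s t => T (f s t)) (T ∘ φ) :=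
  h.mono fun _ hp => (congrArg T hp).trans (map_sub T _ _)

/-- If `f` is additive on all of `J`, then `f x` is itself a primitive there, and two primitives
have equal increments. The points need not be close, which allows coarse samples. -/
theorem IsPrimitive.eq_sub_of_isPreconnected {f : D → D → M} {φ : D → M} (h : IsPrimitive f φ)
    {J : Set D} (hJ : IsPreconnected J)
    (hf : ∀ x ∈ J, ∀ y ∈ J, ∀ z ∈ J, f x y + f y z = f x z) {x y : D} (hx : x ∈ J) (hy : y ∈ J) :
    f x y = φ y - φ x := by
  have : PreconnectedSpace J := isPreconnected_iff_preconnectedSpace.1 hJ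
  have h1 := h.comp (g := ((↑) : J → D)) uniformContinuous_subtype_val
  have h2 : IsPrimitive (fun s t : J => f s t) (fun t => f x t) :=
    Filter.Eventually.of_forall fun p =>
      eq_sub_of_add_eq' (hf x hx p.1 p.1.2 p.2 p.2.2)
  have h3 := h1.sub_eq_sub h2 ⟨x, hx⟩ ⟨y, hy⟩
  have h4 : f x x = 0 := by simpa using hf x hx x hx x hx
  simpa [h4] using h3.symm

/-- A discrete Poincaré lemma: `φ x` sums `f` over small equal steps along the straight segment from
a base point `p` to `x`. For close `x`, `y` the two segments bound a thin ladder, and additivity on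
its small triangles gives `f x y = φ y - φ x`. It is applied to the interval and to the standard
triangle. -/
theorem exists_isPrimitive {E : Type*} [NormedAddCommGroup E] [NormedSpace ℝ E] {D : Set E}
    (hc : Convex ℝ D) (hb : Bornology.IsBounded D) {f : D → D → M} {ε : ℝ} (hε : 0 < ε)
    (hf : ∀ x y z, dist x y < ε → dist y z < ε → dist x z < ε → f x y + f y z = f x z) :
    ∃ φ, IsPrimitive f φ := by
  rcases D.eq_empty_or_nonempty with rfl | ⟨p, hp⟩
  · exact ⟨0, Filter.Eventually.of_forall fun q => (Set.notMem_empty _ q.1.2).elim⟩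
  obtain ⟨C, hC⟩ := (Metric.isBounded_iff_subset_closedBall p).1 hb
  -- Steps and rungs are kept below `ε / 2`, so that the diagonals of the ladder stay below `ε`.
  obtain ⟨N, hN⟩ := exists_nat_gt (C / (ε / 2))
  have hC0 : 0 ≤ C := dist_nonneg.trans (hC hp)
  have hN0 : (0 : ℝ) < N := lt_of_le_of_lt (by positivity) hN
  let T : ℕ → unitInterval := fun j => Set.projIcc 0 1 zero_le_one ((j : ℝ) / N)
  let c : D → ℕ → D := fun x j => ⟨AffineMap.lineMap p (x : E) (T j : ℝ),
    hc.lineMap_mem hp x.2 (T j).2⟩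
  have hT0 : ∀ x, c x 0 = ⟨p, hp⟩ := fun x => Subtype.ext (by simp [c, T])
  have hTN : ∀ x, c x N = x := fun x => Subtype.ext (by simp [c, T, hN0.ne'])
  have hstep : ∀ x j, dist (c x j) (c x (j + 1)) < ε / 2 := fun x j => by
    rw [Subtype.dist_eq, dist_lineMap_lineMap]
    have h1 : dist (T j : ℝ) (T (j + 1)) ≤ 1 / N := by
      rw [Real.dist_eq]
      refine (Set.abs_projIcc_sub_projIcc _).trans ?_
      rw [← sub_div, abs_div, abs_of_pos hN0]
      gcongr
      push_cast
      rw [sub_add_cancel_left, abs_neg, abs_one]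
    have h2 : dist p (x : E) ≤ C := by rw [dist_comm]; exact hC x.2
    calc _ ≤ 1 / N * C := mul_le_mul h1 h2 dist_nonneg (by positivity)
      _ < ε / 2 := by
        rw [div_lt_iff₀ (by positivity)] at hN
        rw [one_div_mul_eq_div, div_lt_iff₀ hN0]
        linarith
  have hpar : ∀ x y j, dist (c x j) (c y j) ≤ dist x y := fun x y j => by
    rw [Subtype.dist_eq, Subtype.dist_eq]
    simp only [c, AffineMap.lineMap_apply, vsub_eq_sub, vadd_eq_add]
    rw [dist_add_right, dist_smul₀, dist_sub_right, Real.norm_of_nonneg (T j).2.1]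
    exact mul_le_of_le_one_left dist_nonneg (T j).2.2
  refine ⟨fun x => ∑ j ∈ Finset.range N, f (c x j) (c x (j + 1)), ?_⟩
  refine Filter.mem_of_superset (Metric.dist_mem_uniformity (half_pos hε)) ?_
  rintro ⟨x, y⟩ (hxy : dist x y < ε / 2)
  have hzero : ∀ z, f z z = 0 := fun z => by
    simpa using hf z z z (by simpa) (by simpa) (by simpa)
  -- Induction over the rungs: each square of the ladder is cut by a diagonal into two triangles.
  have key : ∀ n, f (c x n) (c y n) = (∑ j ∈ Finset.range n, f (c y j) (c y (j + 1))) -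
      ∑ j ∈ Finset.range n, f (c x j) (c x (j + 1)) := by
    intro n
    induction n with
    | zero => simp [hT0, hzero]
    | succ n ih =>
      have hxx := hstep x n
      have hyy := hstep y n
      have h0 := (hpar x y n).trans_lt hxy
      have h1 := (hpar x y (n + 1)).trans_lt hxy
      have hd : dist (c x n) (c y (n + 1)) < ε := by
        linarith [dist_triangle (c x n) (c y n) (c y (n + 1))]
      have e1 := hf (c x n) (c y n) (c y (n + 1)) (by linarith) (by linarith) hd
      have e2 := hf (c x n) (c x (n + 1)) (c y (n + 1)) (by linarith) (by linarith) hd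
      rw [Finset.sum_range_succ, Finset.sum_range_succ]
      have e3 := eq_sub_of_add_eq' (e2.trans e1.symm)
      rw [e3, ih]
      abel
  simpa [hTN] using key N

end Primitives

/-! ### Edges of Rips complexes -/

section RipsEdges

variable (F : Type v) [Field F] {X : Type w} [MetricSpace X] (r : Set.Ioi (0 : ℝ))

/-- The simplicial set of ordered simplices of the Rips complex. -/
abbrev RipsSet (X : Type w) [MetricSpace X] (r : Set.Ioi (0 : ℝ)) : SSet.{w} :=
  orderedSimplices (rips X r)

variable {r} in
theorem dist_lt_of_ripsSimplex {n : ℕ} (s : (RipsSet X r) _⦋n⦌) (i j : Fin (n + 1)) :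
    dist (s.1 i) (s.1 j) < r := by
  obtain ⟨σ, hσ, hs⟩ := s.2
  refine (Metric.dist_le_diam_of_mem (Finset.finite_toSet σ).isBounded ?_ ?_).trans_lt hσ.2
  · rw [hs]; exact Set.mem_range_self i
  · rw [hs]; exact Set.mem_range_self j

/-- The simplex of the Rips complex with given vertices. -/
def ripsSimplex {n : ℕ} (x : Fin (n + 1) → X) (h : ∀ i j, dist (x i) (x j) < r) :
    (RipsSet X r) _⦋n⦌ :=
  ⟨x, by
    classical
    refine ⟨Finset.univ.image x, ⟨Finset.univ_nonempty.image x, ?_⟩, by simp⟩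
    obtain ⟨⟨i, j⟩, -, hij⟩ := Finset.exists_max_image (Finset.univ : Finset (Fin (n + 1) × Fin (n + 1)))
      (fun p => dist (x p.1) (x p.2)) Finset.univ_nonempty
    refine (Metric.diam_le_of_forall_dist_le dist_nonneg ?_).trans_lt (h i j)
    simp only [Finset.coe_image, Finset.coe_univ, Set.image_univ, Set.forall_mem_range]
    exact fun a b => hij (a, b) (Finset.mem_univ _)⟩

theorem ripsEdge_dist {x y : X} (h : dist x y < r) (i j : Fin 2) :
    dist (![x, y] i) (![x, y] j) < r := by
  have h0 : (0 : ℝ) < r := r.2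
  fin_cases i <;> fin_cases j <;> simp [h, h0, dist_comm y x]

/-- The class of the edge from `x` to `y` in the Rips complex (zero if there is no such edge). -/
def ripsClass (x y : X) : ChainsModBoundaries.{v, w} F (RipsSet X r) :=
  if h : dist x y < r then edgeClass F (ripsSimplex r ![x, y] (ripsEdge_dist r h)) else 0

variable {r}

theorem edgeClass_eq_ripsClass (e : (RipsSet X r) _⦋1⦌) :
    edgeClass F e = ripsClass F r (e.1 0) (e.1 1) := by
  rw [ripsClass, dif_pos (dist_lt_of_ripsSimplex e 0 1)]
  refine congrArg (edgeClass F) (Subtype.ext (funext fun i => ?_))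
  change Fin 2 at i
  fin_cases i <;> rfl

theorem ripsClass_add {x y z : X} (hxy : dist x y < r) (hyz : dist y z < r) (hxz : dist x z < r) :
    ripsClass F r x y + ripsClass F r y z = ripsClass F r x z := by
  have h0 : (0 : ℝ) < r := r.2
  have h := edgeClass_add F (ripsSimplex (n := 2) r ![x, y, z] fun i j => by
    fin_cases i <;> fin_cases j <;> simp [hxy, hyz, hxz, h0, dist_comm y x, dist_comm z])
  rw [edgeClass_eq_ripsClass, edgeClass_eq_ripsClass, edgeClass_eq_ripsClass, add_comm] at h
  exact h

variable (r) in
theorem ripsClass_self (x : X) : ripsClass F r x x = 0 := by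
  have h0 : dist x x < r := by rw [dist_self]; exact r.2
  simpa using ripsClass_add F h0 h0 h0

/-- A function on pairs of close points that is additive on small triangles extends to the
`1`-chains of the Rips complex modulo boundaries. -/
def ripsLift {M : Type (max v w)} [AddCommGroup M] [Module F M] (f : X → X → M)
    (hf : ∀ x y z, dist x y < r → dist y z < r → dist x z < r → f x y + f y z = f x z) :
    ChainsModBoundaries.{v, w} F (RipsSet X r) →ₗ[F] M :=
  edgeLift (fun e => f (e.1 0) (e.1 1)) fun s => by
    rw [add_comm]
    exact hf (s.1 0) (s.1 1) (s.1 2) (dist_lt_of_ripsSimplex s 0 1) (dist_lt_of_ripsSimplex s 1 2)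
      (dist_lt_of_ripsSimplex s 0 2)

theorem ripsLift_ripsClass {M : Type (max v w)} [AddCommGroup M] [Module F M] (f : X → X → M)
    (hf : ∀ x y z, dist x y < r → dist y z < r → dist x z < r → f x y + f y z = f x z)
    {x y : X} (h : dist x y < r) : ripsLift F f hf (ripsClass F r x y) = f x y := by
  rw [ripsClass, dif_pos h]
  exact edgeLift_edgeClass _ _ _

/-- A point of `X` as a vertex of the Rips complex. -/
def ripsVertex (r : Set.Ioi (0 : ℝ)) (x : X) : (RipsSet X r) _⦋0⦌ :=
  ripsSimplex r (fun _ => x) fun _ _ => by rw [dist_self]; exact r.2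

theorem ripsVertex_injective (r : Set.Ioi (0 : ℝ)) :
    Function.Injective (ripsVertex (X := X) r) :=
  fun _ _ h => congrFun (congrArg Subtype.val h) (0 : Fin 1)

theorem edgeBoundary_ripsClass {x y : X} (h : dist x y < r) :
    edgeBoundary F (RipsSet X r) (ripsClass F r x y) =
      Finsupp.single (ripsVertex r y) 1 - Finsupp.single (ripsVertex r x) 1 := by
  rw [ripsClass, dif_pos h, edgeBoundary_edgeClass]
  congr 2 <;> refine Subtype.ext (funext fun i => ?_) <;> change Fin 1 at i <;>
    rw [Subsingleton.elim i 0] <;> rfl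

variable (X r) in
/-- The inclusion of the homology of the Rips complex into the `1`-chains modulo boundaries. -/
def ripsIncl : (ripsPersistence.{v, w} F X).obj r →ₗ[F] ChainsModBoundaries.{v, w} F (RipsSet X r) :=
  homologyIncl F (RipsSet X r)

theorem ripsIncl_injective : Function.Injective (ripsIncl.{v, w} F X r) :=
  homologyIncl_injective F

theorem range_ripsIncl :
    LinearMap.range (ripsIncl.{v, w} F X r) = LinearMap.ker (edgeBoundary.{v, w} F (RipsSet X r)) :=
  range_homologyIncl F

theorem edgeBoundary_ripsIncl (z : (ripsPersistence.{v, w} F X).obj r) :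
    edgeBoundary F (RipsSet X r) (ripsIncl F X r z) = 0 := by
  rw [← LinearMap.mem_ker, ← range_ripsIncl]
  exact LinearMap.mem_range_self _ z

theorem ripsIncl_homologyClass (L : RLoop X r) :
    ripsIncl F X r (L.homologyClass F) = ∑ i, ripsClass F r (L.pt i) (L.pt (i + 1)) := by
  refine (homologyIncl_edgeCycleClass F _ L.isEdgeCycle).trans ?_
  simp only [edgeClass_eq_ripsClass]
  rfl

/-- The map of `1`-chains modulo boundaries induced by an inclusion of Rips complexes. -/
def ripsMap {p q : Set.Ioi (0 : ℝ)} (h : p ≤ q) :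
    ChainsModBoundaries.{v, w} F (RipsSet X p) →ₗ[F] ChainsModBoundaries.{v, w} F (RipsSet X q) :=
  edgeMap F (orderedSimplicesMap (rips_mono X h) : RipsSet X p ⟶ RipsSet X q)

theorem ripsMap_ripsClass {p q : Set.Ioi (0 : ℝ)} (h : p ≤ q) {x y : X} (hxy : dist x y < p) :
    ripsMap F h (ripsClass F p x y) = ripsClass F q x y := by
  rw [ripsClass, dif_pos hxy, ripsMap, edgeMap_edgeClass, edgeClass_eq_ripsClass]
  rfl

theorem ripsIncl_map {p q : Set.Ioi (0 : ℝ)} (h : p ⟶ q) (x : (ripsPersistence.{v, w} F X).obj p) :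
    ripsIncl F X q (((ripsPersistence F X).map h).hom x) =
      ripsMap F (leOfHom h) (ripsIncl F X p x) :=
  homologyIncl_homologyMap F (orderedSimplicesMap (rips_mono X (leOfHom h))) x

/-- Every finite set of points is now a face, so coning off from a point `c` contracts the complex.
-/
theorem ripsPersistence_subsingleton (h : ∀ x y : X, dist x y < r) :
    Subsingleton ((ripsPersistence.{v, w} F X).obj r) := by
  refine ⟨fun a b => sub_eq_zero.1 ?_⟩
  generalize a - b = z
  refine ripsIncl_injective F ?_
  rw [map_zero]
  have hz := edgeBoundary_ripsIncl F z
  generalize ripsIncl F X r z = y at hz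
  cases isEmpty_or_nonempty X with
  | inl hX =>
    have : LinearMap.id = (0 : ChainsModBoundaries.{v, w} F (RipsSet X r) →ₗ[F] _) :=
      chainsModBoundaries_ext fun e => (hX.false (e.1 0)).elim
    exact congrArg (fun T => T y) this
  | inr hX =>
    let c : X := Classical.arbitrary X
    let T : ((RipsSet X r) _⦋0⦌ →₀ F) →ₗ[F] ChainsModBoundaries.{v, w} F (RipsSet X r) :=
      Finsupp.linearCombination F fun v => ripsClass F r c (v.1 0)
    -- By the triangle on `c` and the endpoints, an edge is the difference of the two cone edges;
    -- hence a chain with zero boundary vanishes modulo boundaries.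
    have hT : T.comp (edgeBoundary F (RipsSet X r)) = LinearMap.id :=
      chainsModBoundaries_ext fun e => by
        rw [edgeClass_eq_ripsClass, LinearMap.comp_apply, edgeBoundary_ripsClass F (h _ _)]
        have := ripsClass_add F (h c (e.1 0)) (h (e.1 0) (e.1 1)) (h c (e.1 1))
        have hv : ∀ x, T (Finsupp.single (ripsVertex r x) 1) = ripsClass F r c x := fun x =>
          (Finsupp.linearCombination_single F _ _).trans (one_smul _ _)
        rw [map_sub, hv, hv, ← this, add_sub_cancel_left, LinearMap.id_apply]
    have := congrArg (fun T => T y) hT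
    simpa [hz] using this.symm

end RipsEdges

/-! ### Sampling paths -/

section Sampling

open scoped Uniformity Topology

variable (F : Type v) [Field F] {X : Type w} [MetricSpace X] (r : Set.Ioi (0 : ℝ))

variable {r} in
theorem eventually_dist_lt {D : Type*} [UniformSpace D] [CompactSpace D] (g : C(D, X)) :
    ∀ᶠ p in 𝓤 D, dist (g p.1) (g p.2) < r :=
  (CompactSpace.uniformContinuous_of_continuous g.continuous).eventually
    (Metric.dist_mem_uniformity r.2)

theorem exists_isPrimitive_ripsClass {E : Type*} [NormedAddCommGroup E] [NormedSpace ℝ E]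
    {D : Set E} (hD : Convex ℝ D) (hc : IsCompact D) (g : C(D, X)) :
    ∃ φ, IsPrimitive (fun s t => ripsClass.{v, w} F r (g s) (g t)) φ := by
  have := isCompact_iff_compactSpace.1 hc
  obtain ⟨ε, hε, h⟩ := Metric.uniformContinuous_iff.1
    (CompactSpace.uniformContinuous_of_continuous g.continuous) r r.2
  exact exists_isPrimitive hD hc.isBounded hε fun x y z hxy hyz hxz =>
    ripsClass_add F (h hxy) (h hyz) (h hxz)

theorem exists_isPrimitive_path (γ : C(unitInterval, X)) :
    ∃ φ, IsPrimitive (fun s t => ripsClass.{v, w} F r (γ s) (γ t)) φ :=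
  exists_isPrimitive_ripsClass F r (convex_Icc 0 1) isCompact_Icc γ

/-- The class of fine samples of a path in the Rips complex. -/
def sampleClass (γ : C(unitInterval, X)) : ChainsModBoundaries.{v, w} F (RipsSet X r) :=
  (exists_isPrimitive_path F r γ).choose 1 - (exists_isPrimitive_path F r γ).choose 0

variable {r}

theorem sampleClass_eq {γ : C(unitInterval, X)}
    {φ : unitInterval → ChainsModBoundaries.{v, w} F (RipsSet X r)}
    (h : IsPrimitive (fun s t => ripsClass F r (γ s) (γ t)) φ) : sampleClass F r γ = φ 1 - φ 0 :=
  (exists_isPrimitive_path F r γ).choose_spec.sub_eq_sub h 0 1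

/-- The way to compute with samples: a linear image of a sample is the increment of any `ψ` whose
differences match the images of short edges along `γ`. -/
theorem map_sampleClass {M : Type*} [AddCommGroup M] [Module F M] (γ : C(unitInterval, X))
    (T : ChainsModBoundaries.{v, w} F (RipsSet X r) →ₗ[F] M) {ψ : unitInterval → M}
    (h : ∀ᶠ p in 𝓤 unitInterval, dist (γ p.1) (γ p.2) < r →
      T (ripsClass F r (γ p.1) (γ p.2)) = ψ p.2 - ψ p.1) :
    T (sampleClass F r γ) = ψ 1 - ψ 0 := by
  obtain ⟨φ, hφ⟩ := exists_isPrimitive_path F r γ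
  have h1 := hφ.map (T : _ →+ M)
  have h2 : IsPrimitive (fun s t => (T : _ →+ M) (ripsClass F r (γ s) (γ t))) ψ := by
    filter_upwards [h, eventually_dist_lt γ] with p hp hd using hp hd
  rw [sampleClass_eq F hφ, map_sub]
  exact h1.sub_eq_sub h2 0 1

theorem sampleClass_of_dist_lt {γ : C(unitInterval, X)} (h : ∀ s t, dist (γ s) (γ t) < r) :
    sampleClass F r γ = ripsClass F r (γ 0) (γ 1) := by
  obtain ⟨φ, hφ⟩ := exists_isPrimitive_path F r γ
  rw [sampleClass_eq F hφ]
  exact (hφ.eq_sub_of_isPreconnected isPreconnected_univ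
    (fun x _ y _ z _ => ripsClass_add F (h _ _) (h _ _) (h _ _)) trivial trivial).symm

theorem edgeBoundary_sampleClass (γ : C(unitInterval, X)) :
    edgeBoundary F (RipsSet X r) (sampleClass F r γ) =
      Finsupp.single (ripsVertex r (γ 1)) 1 - Finsupp.single (ripsVertex r (γ 0)) 1 :=
  map_sampleClass F γ _ (ψ := fun t => Finsupp.single (ripsVertex r (γ t)) 1)
    (Filter.Eventually.of_forall fun _ hp => edgeBoundary_ripsClass F hp)

theorem ripsMap_sampleClass {p q : Set.Ioi (0 : ℝ)} (h : p ≤ q) (γ : C(unitInterval, X)) :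
    ripsMap F h (sampleClass F p γ) = sampleClass F q γ := by
  obtain ⟨φ, hφ⟩ := exists_isPrimitive_path F q γ
  rw [sampleClass_eq F hφ]
  refine map_sampleClass F γ _ ?_
  filter_upwards [hφ] with s hs hd
  rw [ripsMap_ripsClass F h hd, ← hs]

/-- A primitive on the whole triangle restricts to primitives on its three sides, so the samples of
the sides are differences of its values at the vertices. Hence sampling respects boundaries. -/
theorem sampleClass_faces (s : (Sing X) _⦋2⦌) :
    sampleClass F r (edgePath ((Sing X).δ 0 s)) + sampleClass F r (edgePath ((Sing X).δ 2 s)) =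
      sampleClass F r (edgePath ((Sing X).δ 1 s)) := by
  let τ : C(stdSimplex ℝ (Fin 3), X) := (TopCat.of X).toSSetObjEquiv (.op ⦋2⦌) s
  obtain ⟨φ, hφ⟩ := exists_isPrimitive_ripsClass F r (convex_stdSimplex ℝ (Fin 3))
    (isCompact_stdSimplex ℝ (Fin 3)) τ
  have key : ∀ k : Fin 3, sampleClass F r (edgePath ((Sing X).δ k s)) =
      φ (stdSimplex.vertex (k.succAbove 1)) - φ (stdSimplex.vertex (k.succAbove 0)) := by
    intro k
    let g : unitInterval → stdSimplex ℝ (Fin 3) := fun t =>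
      stdSimplex.map k.succAbove (stdSimplexHomeomorphUnitInterval.symm t)
    have hg : Continuous g :=
      (stdSimplex.continuous_map k.succAbove).comp stdSimplexHomeomorphUnitInterval.symm.continuous
    have h1 := hφ.comp (CompactSpace.uniformContinuous_of_continuous hg)
    have g1 : g 1 = stdSimplex.vertex (k.succAbove 1) := by
      have : stdSimplexHomeomorphUnitInterval.symm 1 = stdSimplex.vertex (1 : Fin 2) :=
        stdSimplexHomeomorphUnitInterval.symm_apply_eq.2 stdSimplexHomeomorphUnitInterval_one.symm
      simp only [g, this, stdSimplex.map_vertex]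
    have g0 : g 0 = stdSimplex.vertex (k.succAbove 0) := by
      have : stdSimplexHomeomorphUnitInterval.symm 0 = stdSimplex.vertex (0 : Fin 2) :=
        stdSimplexHomeomorphUnitInterval.symm_apply_eq.2 stdSimplexHomeomorphUnitInterval_zero.symm
      simp only [g, this, stdSimplex.map_vertex]
    have h2 := sampleClass_eq F (γ := edgePath ((Sing X).δ k s)) h1
    rw [h2, Function.comp_apply, Function.comp_apply, g0, g1]
  rw [key, key, key]
  exact sub_add_sub_cancel _ _ _

variable (X r) in
/-- Sampling, on the singular `1`-chains modulo boundaries. -/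
def sampleLift : ChainsModBoundaries.{v, w} F (Sing X) →ₗ[F]
    ChainsModBoundaries.{v, w} F (RipsSet X r) :=
  edgeLift (fun e => sampleClass F r (edgePath e)) (sampleClass_faces F)

theorem sampleLift_pathClass (γ : C(unitInterval, X)) :
    sampleLift F X r (pathClass F γ) = sampleClass F r γ := by
  rw [pathClass, sampleLift, edgeLift_edgeClass, edgePath_pathEdge]

theorem edgeClass_eq_pathClass (e : (Sing X) _⦋1⦌) :
    edgeClass.{v, w} F e = pathClass F (edgePath e) := by
  rw [pathClass, pathEdge_edgePath]

theorem sing_ext {M : Type (max v w)} [AddCommGroup M] [Module F M]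
    {f g : ChainsModBoundaries.{v, w} F (Sing X) →ₗ[F] M}
    (h : ∀ γ, f (pathClass F γ) = g (pathClass F γ)) : f = g :=
  chainsModBoundaries_ext fun e => by rw [edgeClass_eq_pathClass, h]

/-- The point of `X` at a singular vertex. -/
def vertexPoint (p : (Sing X) _⦋0⦌) : X :=
  (TopCat.of X).toSSetObjEquiv (.op ⦋0⦌) p (stdSimplex.vertex (S := ℝ) (0 : Fin 1))

theorem vertexPoint_injective : Function.Injective (vertexPoint (X := X)) := fun p q h => by
  refine ((TopCat.of X).toSSetObjEquiv (.op ⦋0⦌)).injective (ContinuousMap.ext fun x => ?_)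
  have hx : x = stdSimplex.vertex 0 := Subsingleton.elim (α := stdSimplex ℝ (Fin 1)) _ _
  rw [hx]
  exact h

theorem edgeBoundary_sampleLift (y : ChainsModBoundaries.{v, w} F (Sing X)) :
    edgeBoundary F (RipsSet X r) (sampleLift F X r y) =
      Finsupp.lmapDomain F F (ripsVertex r ∘ vertexPoint) (edgeBoundary F (Sing X) y) := by
  have : (edgeBoundary F (RipsSet X r)).comp (sampleLift F X r) =
      (Finsupp.lmapDomain F F (ripsVertex r ∘ vertexPoint)).comp (edgeBoundary F (Sing X)) := by
    refine sing_ext F fun γ => ?_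
    rw [LinearMap.comp_apply, LinearMap.comp_apply, sampleLift_pathClass,
      edgeBoundary_sampleClass, edgeBoundary_pathClass, map_sub, Finsupp.lmapDomain_apply,
      Finsupp.lmapDomain_apply, Finsupp.mapDomain_single, Finsupp.mapDomain_single]
    rfl
  exact congrArg (fun T => T y) this

/-- Sampling keeps endpoints and the induced map on vertices is injective, so cycles are both
preserved and detected. -/
theorem edgeBoundary_sampleLift_eq_zero_iff (y : ChainsModBoundaries.{v, w} F (Sing X)) :
    edgeBoundary F (RipsSet X r) (sampleLift F X r y) = 0 ↔ edgeBoundary F (Sing X) y = 0 := by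
  rw [edgeBoundary_sampleLift]
  exact map_eq_zero_iff _ (Finsupp.mapDomain_injective
    ((ripsVertex_injective r).comp vertexPoint_injective))

theorem sampleLift_singIncl_mem (x : H1.{v, w} F X) :
    sampleLift F X r (singIncl F X x) ∈ LinearMap.range (ripsIncl.{v, w} F X r) := by
  rw [range_ripsIncl, LinearMap.mem_ker, edgeBoundary_sampleLift_eq_zero_iff, ← LinearMap.mem_ker,
    ← range_singIncl]
  exact LinearMap.mem_range_self _ x

variable (X r) in
/-- Sampling, from `H₁(X; F)` to the first homology of the Rips complex. -/
def sampleHom : H1.{v, w} F X →ₗ[F] (ripsPersistence.{v, w} F X).obj r :=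
  (LinearEquiv.ofInjective (ripsIncl F X r) (ripsIncl_injective F)).symm.toLinearMap.comp
    (((sampleLift F X r).comp (singIncl F X)).codRestrict _ (sampleLift_singIncl_mem F))

theorem ripsIncl_sampleHom (x : H1.{v, w} F X) :
    ripsIncl F X r (sampleHom F X r x) = sampleLift F X r (singIncl F X x) :=
  congrArg Subtype.val ((LinearEquiv.ofInjective (ripsIncl F X r)
    (ripsIncl_injective F)).apply_symm_apply _)

theorem ripsIncl_sampleHom_homologyClass (α : Loop X) :
    ripsIncl F X r (sampleHom F X r (α.homologyClass F)) =
      sampleClass F r α.path.toContinuousMap := by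
  rw [ripsIncl_sampleHom, singIncl_homologyClass, sampleLift_pathClass]

theorem ripsPersistence_map_sampleHom {p q : Set.Ioi (0 : ℝ)} (h : p ⟶ q) (x : H1.{v, w} F X) :
    ((ripsPersistence.{v, w} F X).map h).hom (sampleHom F X p x) = sampleHom F X q x := by
  refine ripsIncl_injective F ?_
  rw [ripsIncl_map, ripsIncl_sampleHom, ripsIncl_sampleHom]
  have : (ripsMap F (leOfHom h)).comp (sampleLift F X p) = sampleLift F X q :=
    sing_ext F fun γ => by
      rw [LinearMap.comp_apply, sampleLift_pathClass, sampleLift_pathClass, ripsMap_sampleClass]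
  exact congrArg (fun T => T (singIncl F X x)) this

/-- The geodesic joining the ends of an edge has diameter `< r`, so it samples to that edge. -/
theorem sampleLift_surjective (hX : IsGeodesicSpace X) :
    Function.Surjective (sampleLift.{v, w} F X r) := by
  rw [← LinearMap.range_eq_top, eq_top_iff, ← span_edgeClass, Submodule.span_le]
  rintro _ ⟨e, rfl⟩
  have he : dist (e.1 0) (e.1 1) < r := dist_lt_of_ripsSimplex e 0 1
  refine ⟨geodesicClass F hX (e.1 0) (e.1 1), ?_⟩
  refine Eq.trans ?_ (edgeClass_eq_ripsClass F e).symm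
  rw [geodesicClass, sampleLift_pathClass, sampleClass_of_dist_lt]
  · exact congrArg₂ _ (Path.source _) (Path.target _)
  · exact fun s t => (dist_geodesic_le hX _ _ s t).trans_lt he

/-- A chain that samples to a cycle is itself a cycle, so surjectivity passes from chains to
homology. -/
theorem sampleHom_surjective (hX : IsGeodesicSpace X) :
    Function.Surjective (sampleHom.{v, w} F X r) := fun z => by
  obtain ⟨y, hy⟩ := sampleLift_surjective F hX (ripsIncl F X r z)
  have h := edgeBoundary_ripsIncl F z
  rw [← hy, edgeBoundary_sampleLift_eq_zero_iff, ← LinearMap.mem_ker, ← range_singIncl] at h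
  obtain ⟨x, rfl⟩ := h
  exact ⟨x, ripsIncl_injective F ((ripsIncl_sampleHom F x).trans hy)⟩

/-- Replacing edges by geodesics is additive modulo `W`, by the triangle estimate, and gives a left
inverse `T` of sampling modulo `W`. A class killed by sampling therefore lies in `W`. -/
theorem ker_sampleHom_le [CompactSpace X] (hX : IsGeodesicSpace X) (h : IsSLSC.{v, w} F X) :
    LinearMap.ker (sampleHom.{v, w} F X r) ≤ shortLoopSpan F X r := by
  let W := (shortLoopSpan.{v, w} F X r).map (singIncl F X)
  let T : ChainsModBoundaries.{v, w} F (RipsSet X r) →ₗ[F] ChainsModBoundaries F (Sing X) ⧸ W :=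
    ripsLift F (fun x y => W.mkQ (geodesicClass F hX x y)) fun x y z hxy hyz hxz => by
      rw [← map_add, ← sub_eq_zero, ← map_sub, Submodule.mkQ_apply, Submodule.Quotient.mk_eq_zero,
        add_comm]
      exact geodesicClass_triangle_mem F hX hxy hyz hxz
  have hT : T.comp (sampleLift F X r) = W.mkQ := sing_ext F fun γ => by
    rw [LinearMap.comp_apply, sampleLift_pathClass,
      -- The class of the initial segment of `γ` up to `t` is the required primitive, since short
      -- segments agree with geodesics.
      map_sampleClass F γ T (ψ := fun t => W.mkQ (segClass F γ 0 t)), ← map_sub,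
      segClass_self, sub_zero, segClass_zero_one]
    filter_upwards [eventually_segClass_eq_geodesicClass F hX h γ] with p hp hd
    rw [ripsLift_ripsClass F _ _ hd, ← hp, ← map_sub, ← segClass_add F γ 0 p.1 p.2,
      add_sub_cancel_left]
  intro x hx
  have h1 : sampleLift F X r (singIncl F X x) = 0 := by
    rw [← ripsIncl_sampleHom, LinearMap.mem_ker.1 hx, map_zero]
  have h2 : W.mkQ (singIncl F X x) = 0 := by
    rw [← hT, LinearMap.comp_apply, h1, map_zero]
  rw [Submodule.mkQ_apply, Submodule.Quotient.mk_eq_zero] at h2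
  obtain ⟨y, hy, hyx⟩ := h2
  rwa [← singIncl_injective F hyx]

end Sampling

/-! ### Samples and short loops -/

section ShortLoops

open scoped Topology

variable (F : Type v) [Field F] {X : Type w} [MetricSpace X] {r : Set.Ioi (0 : ℝ)}

/-- On each arc of diameter `< r` the edge between two points is an increment of the primitive `φ`,
however far apart their parameters are, so the sum over the sample telescopes. -/
theorem sampleHom_homologyClass_of_isSampleOf (α : Loop X) (L : RLoop X r) (hL : L.IsSampleOf α) :
    sampleHom F X r (α.homologyClass F) = L.homologyClass F := by
  obtain ⟨t, ht, hpt, hd, hd'⟩ := hL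
  obtain ⟨φ, hφ⟩ := exists_isPrimitive_path F r α.path.toContinuousMap
  -- `Metric.diam` is `0` on unbounded sets, so boundedness is needed before it controls distances.
  have hbd : ∀ s : Set unitInterval, Bornology.IsBounded (α.path '' s) := fun s =>
    (isCompact_range α.path.continuous).isBounded.subset (Set.image_subset_range _ _)
  have key : ∀ J : Set unitInterval, J.OrdConnected → Metric.diam (α.path '' J) < r →
      ∀ s ∈ J, ∀ u ∈ J, ripsClass F r (α.path s) (α.path u) = φ u - φ s := by
    intro J hJ hJd s hs u hu
    have hlt : ∀ a ∈ J, ∀ b ∈ J, dist (α.path a) (α.path b) < r := fun a ha b hb =>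
      (Metric.dist_le_diam_of_mem (hbd J) ⟨a, ha, rfl⟩ ⟨b, hb, rfl⟩).trans_lt hJd
    exact hφ.eq_sub_of_isPreconnected hJ.isPreconnected (fun x hx y hy z hz =>
      ripsClass_add F (hlt x hx y hy) (hlt y hy z hz) (hlt x hx z hz)) hs hu
  refine ripsIncl_injective F ?_
  rw [ripsIncl_sampleHom_homologyClass, ripsIncl_homologyClass, sampleClass_eq F hφ]
  -- The closing edge passes through the base point, where the parameter jumps from `1` to `0`; the
  -- jump contributes `φ 1 - φ 0`, which is the whole sum once the cyclic differences cancel.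
  have hterm : ∀ i, ripsClass F r (L.pt i) (L.pt (i + 1)) =
      (φ (t (i + 1)) - φ (t i)) + if i = Fin.last L.m then φ 1 - φ 0 else 0 := by
    intro i
    rw [hpt, hpt]
    induction i using Fin.lastCases with
    | last =>
      rw [if_pos rfl, Fin.last_add_one]
      have hlt : ∀ a ∈ Set.Iic (t 0) ∪ Set.Ici (t (Fin.last L.m)),
          ∀ b ∈ Set.Iic (t 0) ∪ Set.Ici (t (Fin.last L.m)),
          dist (α.path a) (α.path b) < r := fun a ha b hb =>
        (Metric.dist_le_diam_of_mem (hbd _) ⟨a, ha, rfl⟩ ⟨b, hb, rfl⟩).trans_lt hd'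
      have e1 := key (Set.Ici (t (Fin.last L.m))) Set.ordConnected_Ici
        ((Metric.diam_mono (Set.image_mono Set.subset_union_right) (hbd _)).trans_lt hd')
        (t (Fin.last L.m)) (Set.mem_Ici.2 le_rfl) 1 unitInterval.le_one'
      have e2 := key (Set.Iic (t 0)) Set.ordConnected_Iic
        ((Metric.diam_mono (Set.image_mono Set.subset_union_left) (hbd _)).trans_lt hd')
        0 unitInterval.nonneg' (t 0) (Set.mem_Iic.2 le_rfl)
      rw [α.path.target] at e1
      rw [α.path.source] at e2
      have h1 := hlt _ (Or.inr (Set.mem_Ici.2 le_rfl)) 1 (Or.inr unitInterval.le_one')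
      have h2 := hlt 0 (Or.inl unitInterval.nonneg') _ (Or.inl (Set.mem_Iic.2 le_rfl))
      rw [α.path.target] at h1
      rw [α.path.source] at h2
      rw [← ripsClass_add F h1 h2 (hlt _ (Or.inr (Set.mem_Ici.2 le_rfl)) _ (Or.inl (Set.mem_Iic.2 le_rfl))), e1, e2]
      abel
    | cast i =>
      rw [if_neg (Fin.castSucc_lt_last i).ne, Fin.coeSucc_eq_succ, add_zero]
      have hle : t i.castSucc ≤ t i.succ := (ht i.castSucc_lt_succ).le
      exact key _ Set.ordConnected_Icc (hd i) _ (Set.left_mem_Icc.2 hle) _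
        (Set.right_mem_Icc.2 hle)
  have hshift : ∑ i, φ (t (i + 1)) = ∑ i, φ (t i) :=
    Equiv.sum_comp (Equiv.addRight (1 : Fin (L.m + 1))) fun i => φ (t i)
  simp only [hterm]
  rw [Finset.sum_add_distrib, Finset.sum_sub_distrib, hshift, sub_self, zero_add,
    Finset.sum_ite_eq' Finset.univ (Fin.last L.m), if_pos (Finset.mem_univ _)]

/-- `V` is arc length from the start. It is continuous because the variation of a continuous path
over `[s, t]` tends to `0` as the endpoints meet. -/
theorem exists_monotone_variation {x : X} (p : Path x x)
    (h : eVariationOn p Set.univ ≠ ⊤) : ∃ V : unitInterval → ℝ, Continuous V ∧ Monotone V ∧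
      V 0 = 0 ∧ V 1 = (eVariationOn p Set.univ).toReal ∧
      ∀ s t, dist (p s) (p t) ≤ |V s - V t| := by
  have hb : BoundedVariationOn p Set.univ := h
  have hfin : ∀ s, eVariationOn p s ≠ ⊤ := fun s =>
    ((eVariationOn.mono p (Set.subset_univ s)).trans_lt (lt_top_iff_ne_top.2 h)).ne
  let V : unitInterval → ℝ := fun t => (eVariationOn p (Set.Iic t)).toReal
  have hadd : ∀ s t, s ≤ t → V t - V s = (eVariationOn p (Set.Icc s t)).toReal := fun s t hst => by
    have : eVariationOn p (Set.Iic t) = eVariationOn p (Set.Iic s) + eVariationOn p (Set.Icc s t) :=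
      (congrArg _ (Set.Iic_union_Icc_eq_Iic hst).symm).trans
        (eVariationOn.union _ isGreatest_Iic (isLeast_Icc hst))
    simp only [V]
    rw [this, ENNReal.toReal_add (hfin _) (hfin _), add_sub_cancel_left]
  have hmono : Monotone V := fun s t hst => sub_nonneg.1 (by rw [hadd s t hst]; positivity)
  refine ⟨V, ?_, hmono, ?_, ?_, ?_⟩
  · refine continuous_iff_continuousAt.2 fun t => ?_
    have hl := hb.tendsto_eVariationOn_Icc_zero_left (x := t)
      p.continuous.continuousAt.continuousWithinAt
    have hr := hb.tendsto_eVariationOn_Icc_zero_right t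
      p.continuous.continuousAt.continuousWithinAt
    simp only [Set.univ_inter, nhdsWithin_univ] at hl hr
    have hl' := (ENNReal.tendsto_toReal ENNReal.zero_ne_top).comp hl
    have hr' := (ENNReal.tendsto_toReal ENNReal.zero_ne_top).comp hr
    have hs := hl'.add hr'
    rw [ContinuousAt, tendsto_iff_dist_tendsto_zero]
    refine squeeze_zero (fun _ => dist_nonneg) (fun s => ?_) (by simpa using hs)
    rw [Real.dist_eq]
    rcases le_total s t with hst | hst
    · rw [abs_sub_comm, hadd s t hst, abs_of_nonneg ENNReal.toReal_nonneg]
      exact le_add_of_nonneg_right ENNReal.toReal_nonneg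
    · rw [hadd t s hst, abs_of_nonneg ENNReal.toReal_nonneg]
      exact le_add_of_nonneg_left ENNReal.toReal_nonneg
  · simp only [V]
    rw [eVariationOn.subsingleton, ENNReal.toReal_zero]
    exact fun a ha b hb => (le_antisymm ha unitInterval.nonneg').trans
      (le_antisymm hb unitInterval.nonneg').symm
  · simp only [V]
    rw [Set.eq_univ_of_forall (s := Set.Iic (1 : unitInterval)) fun t => unitInterval.le_one']
  · have hle : ∀ s t, s ≤ t → dist (p s) (p t) ≤ |V s - V t| := fun s t hst => by
      rw [abs_sub_comm, hadd s t hst, abs_of_nonneg ENNReal.toReal_nonneg, dist_edist]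
      exact ENNReal.toReal_mono (hfin _) (eVariationOn.edist_le p ⟨le_rfl, hst⟩ ⟨hst, le_rfl⟩)
    intro s t
    rcases le_total s t with hst | hst
    · exact hle s t hst
    · rw [dist_comm, abs_sub_comm]
      exact hle t s hst

/-- Arc length takes the values `l / 3` and `2l / 3`, so the loop splits into three arcs of diameter
at most `l / 3 < r`. Its class is then the boundary of the Rips triangle on the three division
points. -/
theorem sampleHom_homologyClass_of_length_lt (α : Loop X)
    (h : α.length < ENNReal.ofReal (3 * r)) : sampleHom F X r (α.homologyClass F) = 0 := by
  obtain ⟨V, hV, hmono, h0, h1, hdist⟩ := exists_monotone_variation α.path h.ne_top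
  obtain ⟨φ, hφ⟩ := exists_isPrimitive_path F r α.path.toContinuousMap
  set l : ℝ := (eVariationOn α.path Set.univ).toReal with hl
  have hlr : l < 3 * r := by
    have := (ENNReal.toReal_lt_toReal h.ne_top ENNReal.ofReal_ne_top).2 h
    rwa [ENNReal.toReal_ofReal (mul_nonneg zero_le_three (le_of_lt r.2))] at this
  have hl0 : 0 ≤ l := ENNReal.toReal_nonneg
  have ivt : ∀ c ∈ Set.Icc 0 l, ∃ t, V t = c := fun c hc =>
    mem_range_of_exists_le_of_exists_ge hV ⟨0, h0.trans_le hc.1⟩ ⟨1, hc.2.trans_eq h1.symm⟩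
  obtain ⟨t, ht⟩ := ivt (l / 3) ⟨by linarith, by linarith⟩
  obtain ⟨u, hu⟩ := ivt (2 * l / 3) ⟨by linarith, by linarith⟩
  have hlt : ∀ a b, |V a - V b| ≤ l / 3 → dist (α.path a) (α.path b) < r := fun a b hab =>
    ((hdist a b).trans hab).trans_lt (by linarith)
  have key : ∀ (c : ℝ) (a b : unitInterval), V a = c → V b = c + l / 3 →
      ripsClass F r (α.path a) (α.path b) = φ b - φ a := by
    intro c a b ha hb
    have hJ : ∀ x ∈ V ⁻¹' Set.Icc c (c + l / 3), ∀ y ∈ V ⁻¹' Set.Icc c (c + l / 3),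
        dist (α.path x) (α.path y) < r := fun x hx y hy => hlt x y (by
      rw [abs_sub_le_iff]
      constructor <;> linarith [hx.1, hx.2, hy.1, hy.2])
    -- The preimage of an interval under monotone `V` is order-connected, hence preconnected.
    refine hφ.eq_sub_of_isPreconnected (Set.ordConnected_Icc.preimage_mono hmono).isPreconnected
      (fun x hx y hy z hz => ripsClass_add F (hJ x hx y hy) (hJ y hy z hz) (hJ x hx z hz))
      (⟨ha.ge, ?_⟩ : V a ∈ Set.Icc c (c + l / 3)) (⟨?_, hb.le⟩ : V b ∈ Set.Icc c (c + l / 3)) <;>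
      linarith
  have e1 := key 0 0 t h0 (by linarith)
  have e2 := key (l / 3) t u ht (by linarith)
  have e3 := key (2 * l / 3) u 1 hu (by linarith)
  rw [α.path.source] at e1
  rw [α.path.target] at e3
  have d1 := hlt 0 t (by rw [h0, ht, abs_sub_le_iff]; constructor <;> linarith)
  have d2 := hlt t u (by rw [ht, hu, abs_sub_le_iff]; constructor <;> linarith)
  have d3 := hlt u 1 (by rw [hu, h1, abs_sub_le_iff]; constructor <;> linarith)
  rw [α.path.source] at d1
  rw [α.path.target] at d3
  refine ripsIncl_injective F ?_
  rw [ripsIncl_sampleHom_homologyClass, map_zero, sampleClass_eq F hφ]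
  have hsum : φ 1 - φ 0 = ripsClass F r α.base (α.path t) + ripsClass F r (α.path t) (α.path u) +
      ripsClass F r (α.path u) α.base := by
    rw [e1, e2, e3]
    abel
  rw [hsum, ripsClass_add F d1 d2 (by rwa [dist_comm]), ripsClass_add F (by rwa [dist_comm]) d3
    (by rw [dist_self]; exact r.2), ripsClass_self]

theorem ker_sampleHom [CompactSpace X] (hX : IsGeodesicSpace X) (h : IsSLSC.{v, w} F X) :
    LinearMap.ker (sampleHom.{v, w} F X r) = shortLoopSpan F X r := by
  refine le_antisymm (ker_sampleHom_le F hX h) (Submodule.span_le.2 ?_)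
  rintro _ ⟨α, hα, rfl⟩
  exact sampleHom_homologyClass_of_length_lt F α hα

end ShortLoops

/-! ### Length vectors -/

section LengthVectors

theorem div_three_lt_iff {l : ENNReal} {r : ℝ} :
    l / 3 < ENNReal.ofReal r ↔ l < ENNReal.ofReal (3 * r) := by
  rw [ENNReal.div_lt_iff (by simp) (by simp), ENNReal.ofReal_mul zero_le_three, mul_comm]
  simp

-- Sorted vectors are determined by how many entries lie below each threshold. A threshold strictly
-- between `g i` and `f i` would have at least `i + 1` entries of `g` below it but at most `i` of
-- `f`.
open Classical in
theorem le_of_forall_card_le {n : ℕ} {f g : Fin n → ENNReal} (hf : Monotone f) (hg : Monotone g)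
    (h : ∀ r : Set.Ioi (0 : ℝ), (Finset.univ.filter fun i => g i < ENNReal.ofReal (3 * r)).card ≤
      (Finset.univ.filter fun i => f i < ENNReal.ofReal (3 * r)).card) : f ≤ g := by
  intro i
  by_contra! hi
  obtain ⟨q, hgq, hqf⟩ := ENNReal.lt_iff_exists_nnreal_btwn.1 hi
  have hq : (0 : ℝ) < q / 3 := by
    have : (0 : ENNReal) < q := bot_le.trans_lt hgq
    have : 0 < q := by exact_mod_cast this
    positivity
  have he : ENNReal.ofReal (3 * (q / 3 : ℝ)) = q := by
    rw [mul_div_cancel₀ _ (by norm_num), ENNReal.ofReal_coe_nnreal]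
  have h1 := h ⟨q / 3, hq⟩
  simp only [he] at h1
  have h2 : Finset.Iic i ⊆ Finset.univ.filter fun j => g j < q := fun j hj => by
    simpa using (hg (Finset.mem_Iic.1 hj)).trans_lt hgq
  have h3 : (Finset.univ.filter fun j => f j < q) ⊆ Finset.Iio i := fun j hj => by
    by_contra hji
    exact absurd (Finset.mem_filter.1 hj).2
      (not_lt.2 (hqf.le.trans (hf (not_lt.1 (by simpa using hji)))))
  have h4 := Finset.card_le_card h2
  have h5 := Finset.card_le_card h3
  rw [Fin.card_Iic] at h4
  rw [Fin.card_Iio] at h5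
  omega

variable {X : Type w} [MetricSpace X] {n : ℕ} {a : Fin n → Loop X}

/-- `kIndex` counts from `1` and `Fin n` from `0`, hence the strict inequality; sortedness makes the
short loops an initial segment. -/
theorem lt_kIndex_iff (ha : Monotone fun i => (a i).length) (r : Set.Ioi (0 : ℝ)) (i : Fin n) :
    (i : ℕ) < kIndex a r ↔ (a i).length < ENNReal.ofReal (3 * r) := by
  rw [kIndex, Finset.lt_sup_iff]
  simp only [Finset.mem_filter, Finset.mem_univ, true_and, div_three_lt_iff]
  constructor
  · rintro ⟨j, hj, hij⟩
    exact (ha (Fin.le_def.2 (Nat.lt_succ_iff.1 hij))).trans_lt hj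
  · exact fun h => ⟨i, h, Nat.lt_succ_self _⟩

theorem shortSpan_eq (F : Type v) [Field F] (ha : Monotone fun i => (a i).length)
    (r : Set.Ioi (0 : ℝ)) : shortSpan.{v, w} F a r =
      Submodule.span F ((fun i => (a i).homologyClass F) ''
        {i | (a i).length < ENNReal.ofReal (3 * r)}) := by
  simp only [shortSpan, lt_kIndex_iff ha]

theorem shortSpan_le (F : Type v) [Field F] (ha : Monotone fun i => (a i).length)
    (r : Set.Ioi (0 : ℝ)) : shortSpan.{v, w} F a r ≤ shortLoopSpan F X r := by
  rw [shortSpan_eq F ha]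
  refine Submodule.span_mono ?_
  rintro _ ⟨i, hi, rfl⟩
  exact ⟨a i, hi, rfl⟩

end LengthVectors

/-! ### Bases of loops -/

section Bases

variable {F : Type v} [Field F] {X : Type w} [MetricSpace X] {n : ℕ} {a : Fin n → Loop X}

theorem IsBase.linearIndependent (h : IsBase.{v, w} F a) :
    LinearIndependent F fun i => (a i).homologyClass.{v, w} F := by
  obtain ⟨⟨e⟩, -, hspan⟩ := h
  refine linearIndependent_of_top_le_span_of_card_eq_finrank hspan.ge ?_
  rw [e.finrank_eq, Module.finrank_fin_fun, Fintype.card_fin]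

/-- The basis of `H₁(X; F)` given by a base of loops. -/
def IsBase.basis (h : IsBase.{v, w} F a) : Module.Basis (Fin n) F (H1.{v, w} F X) :=
  Module.Basis.mk h.linearIndependent h.2.2.ge

theorem IsBase.basis_apply (h : IsBase.{v, w} F a) (i : Fin n) :
    h.basis i = (a i).homologyClass F :=
  Module.Basis.mk_apply _ _ i

-- Steinitz exchange: a short loop outside the span of the short base loops could replace a long
-- base loop, giving a base with a smaller length vector.
open Classical in
theorem IsLexMinBase.shortSpan_eq_shortLoopSpan (h : IsLexMinBase.{v, w} F a)
    (r : Set.Ioi (0 : ℝ)) : shortSpan.{v, w} F a r = shortLoopSpan F X r := by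
  have hmono := h.1.2.1
  refine le_antisymm (shortSpan_le F hmono r) (Submodule.span_le.2 ?_)
  rintro _ ⟨α, hα, rfl⟩
  by_contra hmem
  rw [shortSpan_eq F hmono] at hmem
  set x := α.homologyClass.{v, w} F with hx
  change x ∉ Submodule.span F _ at hmem
  -- Otherwise the expansion of `x` would involve only short base loops.
  obtain ⟨j, hj, hjx⟩ : ∃ j, ¬ (a j).length < ENNReal.ofReal (3 * r) ∧ h.1.basis.repr x j ≠ 0 := by
    by_contra! hall
    refine hmem ?_
    rw [← h.1.basis.sum_repr x]
    refine Submodule.sum_mem _ fun i _ => ?_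
    by_cases hi : (a i).length < ENNReal.ofReal (3 * r)
    · refine Submodule.smul_mem _ _ (Submodule.subset_span ⟨i, hi, ?_⟩)
      rw [h.1.basis_apply]
    · rw [hall i (not_lt.1 hi), zero_smul]
      exact Submodule.zero_mem _
  let b : Fin n → Loop X := Function.update a j α
  -- The exchange may destroy the ordering by length, so the new family is sorted again.
  let σ : Equiv.Perm (Fin n) := Tuple.sort fun i => (b i).length
  have hbmono : Monotone fun i => ((b ∘ σ) i).length := Tuple.monotone_sort fun i => (b i).length
  have hspan : Submodule.span F (Set.range fun i => ((b ∘ σ) i).homologyClass.{v, w} F) = ⊤ := by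
    have hrange : (Set.range fun i => ((b ∘ σ) i).homologyClass.{v, w} F) =
        Set.range fun i => (b i).homologyClass F :=
      σ.surjective.range_comp fun i => (b i).homologyClass.{v, w} F
    rw [hrange, eq_top_iff, ← h.1.2.2, Submodule.span_le]
    have hne : ∀ i, i ≠ j → (a i).homologyClass.{v, w} F ∈
        Submodule.span F (Set.range fun i => (b i).homologyClass.{v, w} F) := fun i hi =>
      Submodule.subset_span ⟨i, by simp only [b, Function.update_of_ne hi]⟩
    rintro _ ⟨i, rfl⟩
    by_cases hi : i = j
    · subst hi
      have hxmem : x ∈ Submodule.span F (Set.range fun i => (b i).homologyClass.{v, w} F) :=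
        Submodule.subset_span ⟨i, by simp only [b, Function.update_self, hx]⟩
      rw [← h.1.basis.sum_repr x, ← Finset.add_sum_erase _ _ (Finset.mem_univ i),
        Submodule.add_mem_iff_left, h.1.basis_apply] at hxmem
      -- The nonzero coefficient lets the discarded class be recovered from `x` and the remaining
      -- loops.
      · exact (Submodule.smul_mem_iff _ hjx).1 hxmem
      · refine Submodule.sum_mem _ fun k hk => Submodule.smul_mem _ _ ?_
        rw [h.1.basis_apply]
        exact hne k (Finset.ne_of_mem_erase hk)
    · exact hne i hi
  have hcount : ∀ c : ENNReal, (Finset.univ.filter fun i => ((b ∘ σ) i).length < c).card =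
      (Finset.univ.filter fun i => (b i).length < c).card := fun c =>
    Finset.card_equiv σ (by simp)
  have hlt : α.length < (a j).length := hα.trans_le (not_lt.1 hj)
  have hsub : ∀ c : ENNReal, (Finset.univ.filter fun i => (a i).length < c) ⊆
      Finset.univ.filter fun i => (b i).length < c := fun c i hi => by
    rw [Finset.mem_filter] at hi ⊢
    refine ⟨hi.1, ?_⟩
    by_cases hij : i = j
    · subst hij
      simp only [b, Function.update_self]
      exact hlt.trans hi.2
    · simp only [b, Function.update_of_ne hij]
      exact hi.2
  have hle : (fun i => ((b ∘ σ) i).length) ≤ fun i => (a i).length :=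
    le_of_forall_card_le hbmono hmono fun s => by
      rw [hcount]
      exact Finset.card_le_card (hsub _)
  -- Minimality forces equal length vectors, yet the exchange strictly increases the number of loops
  -- of length `< 3r`.
  have heq : (fun i => (a i).length) = fun i => ((b ∘ σ) i).length :=
    toLex.injective (le_antisymm (h.2 (b ∘ σ) ⟨h.1.1, hbmono, hspan⟩) (Pi.toLex_monotone hle))
  have hss : (Finset.univ.filter fun i => (a i).length < ENNReal.ofReal (3 * r)) ⊂
      Finset.univ.filter fun i => (b i).length < ENNReal.ofReal (3 * r) := by
    refine (Finset.ssubset_iff_of_subset (hsub _)).2 ⟨j, ?_, by simpa using hj⟩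
    simpa [b] using hα
  refine (Finset.card_lt_card hss).ne ?_
  rw [← hcount]
  simp only [congrFun heq]

-- The short loops of any base `b` are independent in `shortLoopSpan`, so `b` has at most as many as
-- `a` at every scale. Thus `a` is minimal entry by entry, which is stronger than lexicographically.
open Classical in
theorem isLexMinBase_of_finrank (e : Nonempty (H1.{v, w} F X ≃ₗ[F] (Fin n → F)))
    (ha : Monotone fun i => (a i).length)
    (hspan : Submodule.span F (Set.range fun i => (a i).homologyClass.{v, w} F) = ⊤)
    (hrank : ∀ r : Set.Ioi (0 : ℝ), Module.finrank F (shortLoopSpan.{v, w} F X r) =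
      (Finset.univ.filter fun i => (a i).length < ENNReal.ofReal (3 * r)).card) :
    IsLexMinBase.{v, w} F a := by
  refine ⟨⟨e, ha, hspan⟩, fun b hb => Pi.toLex_monotone (le_of_forall_card_le ha hb.2.1 fun r => ?_)⟩
  have : Module.Finite F (H1.{v, w} F X) := Module.Finite.equiv e.some.symm
  rw [← hrank r]
  have hli := hb.linearIndependent.comp
    (fun i : (Finset.univ.filter fun i => (b i).length < ENNReal.ofReal (3 * r) : Finset (Fin n)) =>
      (i : Fin n)) Subtype.val_injective
  have h1 := finrank_span_eq_card hli
  rw [Fintype.card_coe] at h1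
  rw [← h1]
  refine Submodule.finrank_mono (Submodule.span_mono ?_)
  rintro _ ⟨i, rfl⟩
  exact ⟨b i, (Finset.mem_filter.1 i.2).2, rfl⟩

end Bases

/-! ### Persistences -/

section Persistences

variable (F : Type v) [Field F] {X : Type w} [MetricSpace X] {n : ℕ} {a : Fin n → Loop X}

/-- The isomorphism from the quotient persistence to the Rips persistence given by sampling. -/
def quotientIsoRips [CompactSpace X] (hX : IsGeodesicSpace X) (h : IsSLSC.{v, w} F X)
    (ha : ∀ r, shortSpan.{v, w} F a r = shortLoopSpan F X r) :
    quotientPersistence.{v, w} F a ≅ ripsPersistence F X :=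
  NatIso.ofComponents (fun r => LinearEquiv.toModuleIso
    ((Submodule.quotEquivOfEq _ _ ((ha r).trans (ker_sampleHom F hX h).symm)).trans
      ((sampleHom F X r).quotKerEquivOfSurjective (sampleHom_surjective F hX))))
    fun f => ModuleCat.hom_ext (Submodule.linearMap_qext _ (LinearMap.ext fun x =>
      (ripsPersistence_map_sampleHom F f x).symm))

theorem quotientIsoRips_isInducedBySamples [CompactSpace X] (hX : IsGeodesicSpace X)
    (h : IsSLSC.{v, w} F X) (ha : ∀ r, shortSpan.{v, w} F a r = shortLoopSpan F X r) :
    IsInducedBySamples (quotientIsoRips F hX h ha) := fun _ α L hL =>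
  sampleHom_homologyClass_of_isSampleOf F α L hL

theorem mem_Ioc0_iff {l : ENNReal} {r : Set.Ioi (0 : ℝ)} :
    r ∈ Ioc0 (l / 3) ↔ ¬ l < ENNReal.ofReal (3 * r) := by
  rw [← div_three_lt_iff, not_lt]
  rfl

open Classical in
/-- The standard generator of an interval persistence. -/
def intervalGen (I : Set (Set.Ioi (0 : ℝ))) (hI : I.OrdConnected) (r : Set.Ioi (0 : ℝ)) :
    (intervalPersistence.{v, w} F I hI).obj r :=
  (if h : r ∈ I then ⟨ULift.up 1, fun h' => absurd h h'⟩ else 0 : intervalObj.{v, w} F I r)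

variable {I : Set (Set.Ioi (0 : ℝ))} (hI : I.OrdConnected)

theorem intervalGen_eq_zero {r : Set.Ioi (0 : ℝ)} (hr : r ∉ I) :
    intervalGen.{v, w} F I hI r = 0 :=
  dif_neg hr

theorem intervalPersistence_map_intervalGen (h : ∀ q ∈ I, ∀ p ≤ q, p ∈ I)
    {p q : Set.Ioi (0 : ℝ)} (f : p ⟶ q) :
    ((intervalPersistence.{v, w} F I hI).map f).hom (intervalGen F I hI p) =
      intervalGen F I hI q := by
  change intervalMap F I p q _ = _
  by_cases hq : q ∈ I
  · simp [intervalMap, intervalGen, hq, h q hq p (leOfHom f)]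
  · simp [intervalMap, intervalGen, hq]

theorem exists_smul_intervalGen (r : Set.Ioi (0 : ℝ))
    (y : (intervalPersistence.{v, w} F I hI).obj r) : ∃ c : F, c • intervalGen F I hI r = y := by
  change intervalObj.{v, w} F I r at y
  refine ⟨y.1.down, Subtype.ext (ULift.ext _ _ ?_)⟩
  change y.1.down * (intervalGen F I hI r : intervalObj.{v, w} F I r).1.down = y.1.down
  by_cases hr : r ∈ I
  · simp [intervalGen, hr]
  · simp [y.2 hr]

theorem intervalGen_ne_zero {r : Set.Ioi (0 : ℝ)} (hr : r ∈ I) :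
    intervalGen.{v, w} F I hI r ≠ 0 := fun h => by
  have := congrArg (fun y : intervalObj.{v, w} F I r => y.1.down) h
  simp only [intervalGen, dif_pos hr] at this
  exact one_ne_zero this

open Classical in
theorem finrank_intervalObj (I : Set (Set.Ioi (0 : ℝ))) (r : Set.Ioi (0 : ℝ)) :
    Module.finrank F (intervalObj.{v, w} F I r) = if r ∈ I then 1 else 0 := by
  split_ifs with hr
  · have : intervalObj.{v, w} F I r = ⊤ := eq_top_iff.2 fun x _ h => absurd hr h
    rw [this, finrank_top, (ULift.moduleEquiv : ULift.{w} F ≃ₗ[F] F).finrank_eq,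
      Module.finrank_self]
  · have : intervalObj.{v, w} F I r = ⊥ := eq_bot_iff.2 fun x hx => hx hr
    rw [this, finrank_bot]

open Classical in
theorem finrank_directSum_interval (l : Fin n → ENNReal) (r : Set.Ioi (0 : ℝ)) :
    Module.finrank F ((directSum.{v, w} F fun i =>
      intervalPersistence F (Ioc0 (l i / 3)) (ordConnected_Ioc0 _)).obj r) =
      (Finset.univ.filter fun i => ¬ l i < ENNReal.ofReal (3 * r)).card := by
  have : Module.Finite F (ULift.{w} F) := Module.Finite.equiv ULift.moduleEquiv.symm
  refine (Module.finrank_directSum F fun i => intervalObj.{v, w} F (Ioc0 (l i / 3)) r).trans ?_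
  simp only [finrank_intervalObj, mem_Ioc0_iff]
  rw [Finset.card_filter]

variable (a) in
/-- The interval persistences with right endpoints a third of the lengths of the loops. -/
abbrev lengthIntervals (i : Fin n) : Persistence.{v, w} F :=
  intervalPersistence F (Ioc0 ((a i).length / 3)) (ordConnected_Ioc0 _)

/-- The generators of the summands define a map from `H₁(X; F)` to the direct sum of interval
persistences. -/
def toIntervals (b : Module.Basis (Fin n) F (H1.{v, w} F X)) (a : Fin n → Loop X)
    (r : Set.Ioi (0 : ℝ)) :
    H1.{v, w} F X →ₗ[F] DirectSum (Fin n) fun i => (lengthIntervals.{v, w} F a i).obj r :=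
  b.constr F fun i => DirectSum.lof F (Fin n) (fun i => (lengthIntervals.{v, w} F a i).obj r) i
    (intervalGen F _ (ordConnected_Ioc0 ((a i).length / 3)) r)

theorem toIntervals_apply (b : Module.Basis (Fin n) F (H1.{v, w} F X)) (r : Set.Ioi (0 : ℝ))
    (x : H1.{v, w} F X) (i : Fin n) : toIntervals F b a r x i =
      b.repr x i • intervalGen F _ (ordConnected_Ioc0 ((a i).length / 3)) r := by
  rw [toIntervals, Module.Basis.constr_apply_fintype, DirectSum.sum_apply]
  rw [Finset.sum_eq_single i]
  · rw [DirectSum.smul_apply, DirectSum.lof_apply]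
    rfl
  · intro j _ hj
    rw [DirectSum.smul_apply, DirectSum.lof_eq_of, DirectSum.of_eq_of_ne _ _ _ hj.symm, smul_zero]
  · simp

theorem toIntervals_surjective (b : Module.Basis (Fin n) F (H1.{v, w} F X))
    (r : Set.Ioi (0 : ℝ)) : Function.Surjective (toIntervals F b a r) := fun y => by
  choose c hc using fun i => exists_smul_intervalGen F (ordConnected_Ioc0 ((a i).length / 3)) r (y i)
  refine ⟨∑ i, c i • b i, DFinsupp.ext fun i => ?_⟩
  refine (toIntervals_apply F b r _ i).trans ?_
  rw [b.repr_sum_self, hc]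

/-- Basis vectors whose bar has ended by `r` go to `0`; the others go to nonzero elements of
distinct summands. -/
theorem ker_toIntervals (h : IsBase.{v, w} F a) (r : Set.Ioi (0 : ℝ)) :
    LinearMap.ker (toIntervals F h.basis a r) = shortSpan.{v, w} F a r := by
  rw [shortSpan_eq F h.2.1]
  refine le_antisymm (fun x hx => ?_) (Submodule.span_le.2 ?_)
  · rw [← h.basis.sum_repr x]
    refine Submodule.sum_mem _ fun i _ => ?_
    by_cases hi : (a i).length < ENNReal.ofReal (3 * r)
    · refine Submodule.smul_mem _ _ (Submodule.subset_span ⟨i, hi, ?_⟩)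
      rw [h.basis_apply]
    · have h1 := toIntervals_apply (a := a) F h.basis r x i
      rw [LinearMap.mem_ker.1 hx, DirectSum.zero_apply, eq_comm, smul_eq_zero] at h1
      rw [h1.resolve_right (intervalGen_ne_zero F _ (mem_Ioc0_iff.2 hi)), zero_smul]
      exact Submodule.zero_mem _
  · rintro _ ⟨i, hi, rfl⟩
    have hi' : r ∉ Ioc0 ((a i).length / 3) := fun hr => mem_Ioc0_iff.1 hr hi
    simp only [SetLike.mem_coe, LinearMap.mem_ker]
    rw [← h.basis_apply, toIntervals, Module.Basis.constr_basis, intervalGen_eq_zero F _ hi',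
      map_zero]

theorem directSum_map_toIntervals (b : Module.Basis (Fin n) F (H1.{v, w} F X))
    {p q : Set.Ioi (0 : ℝ)} (f : p ⟶ q) (x : H1.{v, w} F X) :
    DirectSum.lmap (fun i => ((lengthIntervals.{v, w} F a i).map f).hom) (toIntervals F b a p x) =
      toIntervals F b a q x := by
  refine congrArg (fun T => T x) (b.ext (f₁ := (DirectSum.lmap fun i =>
    ((lengthIntervals.{v, w} F a i).map f).hom).comp (toIntervals F b a p)) fun i => ?_)
  rw [LinearMap.comp_apply, toIntervals, toIntervals, Module.Basis.constr_basis,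
    Module.Basis.constr_basis, DirectSum.lmap_lof, intervalPersistence_map_intervalGen]
  exact fun q hq p hpq => (ENNReal.ofReal_le_ofReal hpq).trans hq

/-- The quotient persistence of a base is a direct sum of interval persistences. -/
def quotientIsoDirectSum (h : IsBase.{v, w} F a) :
    quotientPersistence.{v, w} F a ≅ directSum.{v, w} F (lengthIntervals F a) :=
  NatIso.ofComponents (fun r => LinearEquiv.toModuleIso
    ((Submodule.quotEquivOfEq _ _ (ker_toIntervals F h r).symm).trans
      ((toIntervals F h.basis a r).quotKerEquivOfSurjective
        (toIntervals_surjective F h.basis r))))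
    fun f => ModuleCat.hom_ext (Submodule.linearMap_qext _ (LinearMap.ext fun x =>
      (directSum_map_toIntervals F h.basis f x).symm))

/-- The bonding maps are always onto, so only injectivity is at stake. -/
theorem isIso_quotientPersistence_map_iff {p q : Set.Ioi (0 : ℝ)} (f : p ⟶ q) :
    IsIso ((quotientPersistence.{v, w} F a).map f) ↔ shortSpan.{v, w} F a q ≤ shortSpan F a p := by
  have hker : ∀ r x, (shortSpan.{v, w} F a r).mkQ x = 0 ↔ x ∈ shortSpan.{v, w} F a r :=
    fun r x => by rw [Submodule.mkQ_apply, Submodule.Quotient.mk_eq_zero]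
  have hmap : ∀ x, ((quotientPersistence.{v, w} F a).map f).hom ((shortSpan F a p).mkQ x) =
      (shortSpan F a q).mkQ x := fun x => rfl
  rw [ConcreteCategory.isIso_iff_bijective]
  constructor
  · intro h x hx
    refine (hker p x).1 (h.1 ?_)
    exact (hmap x).trans (((hker q x).2 hx).trans (map_zero _).symm)
  · intro h
    constructor
    · refine (injective_iff_map_eq_zero ((quotientPersistence.{v, w} F a).map f).hom).2 fun y hy => ?_
      obtain ⟨x, rfl⟩ := Submodule.mkQ_surjective (shortSpan.{v, w} F a p) y
      exact (hker p x).2 (h ((hker q x).1 hy))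
    · intro y
      obtain ⟨x, rfl⟩ := Submodule.mkQ_surjective (shortSpan.{v, w} F a q) y
      exact ⟨(shortSpan F a p).mkQ x, rfl⟩

end Persistences

/-! ### Critical values -/

section CriticalValues

open Filter Topology

variable {F : Type v} [Field F] {X : Type w} [MetricSpace X] {n : ℕ} {a : Fin n → Loop X}

theorem IsBase.homologyClass_mem_shortSpan_iff (h : IsBase.{v, w} F a) (i : Fin n)
    (r : Set.Ioi (0 : ℝ)) :
    (a i).homologyClass F ∈ shortSpan.{v, w} F a r ↔ (a i).length / 3 < ENNReal.ofReal r := by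
  rw [shortSpan_eq F h.2.1, div_three_lt_iff]
  refine ⟨fun hmem => ?_, fun hi => Submodule.subset_span ⟨i, hi, rfl⟩⟩
  by_contra hi
  exact h.linearIndependent.notMem_span_image (s := {i | (a i).length < ENNReal.ofReal (3 * r)})
    hi hmem

theorem IsBase.isIso_ripsPersistence_map_iff (h : IsBase.{v, w} F a)
    (φ : quotientPersistence.{v, w} F a ≅ ripsPersistence F X) {p q : Set.Ioi (0 : ℝ)}
    (f : p ⟶ q) : IsIso ((ripsPersistence.{v, w} F X).map f) ↔
      ∀ i, (a i).length / 3 < ENNReal.ofReal q → (a i).length / 3 < ENNReal.ofReal p := by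
  rw [← NatIso.isIso_map_iff φ f, isIso_quotientPersistence_map_iff]
  constructor
  · intro hle i hi
    rw [← h.homologyClass_mem_shortSpan_iff] at hi ⊢
    exact hle hi
  · intro hi
    rw [shortSpan_eq F h.2.1, Submodule.span_le]
    rintro _ ⟨i, hiq, rfl⟩
    exact (h.homologyClass_mem_shortSpan_iff i p).2 (hi i (div_three_lt_iff.2 hiq))

/-- The bars are closed on the right, so a change at `l_i / 3` is visible only just after it. Left
critical values do not occur: the finitely many strict inequalities `l_i / 3 < p` persist for `q`
slightly below `p`. -/
theorem IsBase.isCritical_iff (h : IsBase.{v, w} F a)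
    (φ : quotientPersistence.{v, w} F a ≅ ripsPersistence F X) (p : Set.Ioi (0 : ℝ)) :
    IsCritical (ripsPersistence.{v, w} F X) p ↔ ∃ i, (a i).length / 3 = ENNReal.ofReal p := by
  have hp : (0 : ℝ) < p := p.2
  simp only [IsCritical, IsLeftCritical, IsRightCritical, h.isIso_ripsPersistence_map_iff φ]
  push Not
  constructor
  · rintro (⟨δ, hδ, hleft⟩ | hright)
    · have hev : ∀ i, ∀ᶠ q : ℝ in 𝓝[<] (p : ℝ), (a i).length / 3 < ENNReal.ofReal p →
          (a i).length / 3 < ENNReal.ofReal q := fun i => by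
        by_cases hi : (a i).length / 3 < ENNReal.ofReal p
        · filter_upwards [nhdsWithin_le_nhds
            ((ENNReal.continuous_ofReal.tendsto _).eventually (lt_mem_nhds hi))] with q hq _ using hq
        · exact Eventually.of_forall fun q hi' => absurd hi' hi
      have hev0 : ∀ᶠ q : ℝ in 𝓝[<] (p : ℝ), 0 < q := nhdsWithin_le_nhds (lt_mem_nhds hp)
      have hevδ : ∀ᶠ q : ℝ in 𝓝[<] (p : ℝ), (p : ℝ) - δ < q :=
        nhdsWithin_le_nhds (lt_mem_nhds (sub_lt_self _ hδ))
      have hevp : ∀ᶠ q : ℝ in 𝓝[<] (p : ℝ), q < p := self_mem_nhdsWithin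
      obtain ⟨q, hq, hq0, hqp, hqδ⟩ :=
        ((eventually_all.2 hev).and (hev0.and (hevp.and hevδ))).exists
      obtain ⟨i, hi, hi'⟩ := hleft ⟨q, hq0⟩ hqp hqδ
      exact absurd (hq i hi) (not_lt.2 hi')
    · by_contra! hne
      have hev : ∀ i, ∀ᶠ q : ℝ in 𝓝[>] (p : ℝ), ENNReal.ofReal p ≤ (a i).length / 3 →
          ENNReal.ofReal q ≤ (a i).length / 3 := fun i => by
        by_cases hi : ENNReal.ofReal p ≤ (a i).length / 3
        · filter_upwards [nhdsWithin_le_nhds ((ENNReal.continuous_ofReal.tendsto _).eventually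
            (gt_mem_nhds (lt_of_le_of_ne hi (hne i).symm)))] with q hq _ using hq.le
        · exact Eventually.of_forall fun q hi' => absurd hi' hi
      have hevp : ∀ᶠ q : ℝ in 𝓝[>] (p : ℝ), p < q := self_mem_nhdsWithin
      obtain ⟨q, hq, hpq⟩ := ((eventually_all.2 hev).and hevp).exists
      obtain ⟨i, hi, hi'⟩ := hright ⟨q, hp.trans hpq⟩ hpq
      exact absurd hi (not_lt.2 (hq i hi'))
  · rintro ⟨i, hi⟩
    refine Or.inr fun q hpq => ⟨i, ?_, hi.ge⟩
    rw [hi]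
    exact (ENNReal.ofReal_lt_ofReal_iff (hp.trans hpq)).2 hpq

end CriticalValues

/-! ### The main equivalence -/

section Equivalence

variable {F : Type v} [Field F] {X : Type w} [MetricSpace X] [CompactSpace X] {n : ℕ}
  {a : Fin n → Loop X}

theorem exists_forall_dist_lt (X : Type w) [MetricSpace X] [CompactSpace X] :
    ∃ r : Set.Ioi (0 : ℝ), ∀ x y : X, dist x y < r :=
  ⟨⟨Metric.diam (Set.univ : Set X) + 1, add_pos_of_nonneg_of_pos Metric.diam_nonneg one_pos⟩,
    fun _ _ => (Metric.dist_le_diam_of_mem isCompact_univ.isBounded trivial trivial).trans_lt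
      (lt_add_one _)⟩

-- Only dimensions matter: counting living bars computes `dim (H₁(X; F) / W_r)`, hence `dim W_r`,
-- and minimality follows from `isLexMinBase_of_finrank`.
open Classical in
theorem isLexMinBase_of_iso (hX : IsGeodesicSpace X) (h : IsSLSC.{v, w} F X)
    (e : Nonempty (H1.{v, w} F X ≃ₗ[F] (Fin n → F))) (ha : Monotone fun i => (a i).length)
    (φ : quotientPersistence.{v, w} F a ≅ ripsPersistence F X)
    (ψ : quotientPersistence.{v, w} F a ≅ directSum.{v, w} F (lengthIntervals F a)) :
    IsLexMinBase.{v, w} F a := by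
  have : Module.Finite F (H1.{v, w} F X) := Module.Finite.equiv e.some.symm
  have hn : Module.finrank F (H1.{v, w} F X) = n := by
    rw [e.some.finrank_eq, Module.finrank_fin_fun]
  have hψ : ∀ r, Module.finrank F ((quotientPersistence.{v, w} F a).obj r) =
      (Finset.univ.filter fun i => ¬ (a i).length < ENNReal.ofReal (3 * r)).card := fun r =>
    (ψ.app r).toLinearEquiv.finrank_eq.trans
      (finrank_directSum_interval F (fun i => (a i).length) r)
  have hφ : ∀ r, Module.finrank F ((quotientPersistence.{v, w} F a).obj r) =
      Module.finrank F (H1.{v, w} F X ⧸ shortLoopSpan.{v, w} F X r) := fun r =>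
    (φ.app r).toLinearEquiv.finrank_eq.trans
      ((Submodule.quotEquivOfEq _ _ (ker_sampleHom F hX h).symm).trans
        ((sampleHom F X r).quotKerEquivOfSurjective (sampleHom_surjective F hX))).finrank_eq.symm
  have hcard : ∀ r : Set.Ioi (0 : ℝ),
      (Finset.univ.filter fun i => (a i).length < ENNReal.ofReal (3 * r)).card +
        (Finset.univ.filter fun i => ¬ (a i).length < ENNReal.ofReal (3 * r)).card = n := fun r => by
    rw [Finset.card_filter_add_card_filter_not, Finset.card_univ, Fintype.card_fin]
  have hrank : ∀ r : Set.Ioi (0 : ℝ), Module.finrank F (shortLoopSpan.{v, w} F X r) =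
      (Finset.univ.filter fun i => (a i).length < ENNReal.ofReal (3 * r)).card := fun r => by
    have h1 := (shortLoopSpan.{v, w} F X r).finrank_quotient_add_finrank
    have h2 := hcard r
    rw [← hφ r, hψ r, hn] at h1
    omega
  refine isLexMinBase_of_finrank e ha ?_ hrank
  -- Beyond the diameter the Rips homology vanishes, so the quotient by `shortSpan` is zero and the
  -- loops generate.
  obtain ⟨r, hr⟩ := exists_forall_dist_lt X
  have hr0 := ripsPersistence_subsingleton F hr
  have hq : Subsingleton (H1.{v, w} F X ⧸ shortSpan.{v, w} F a r) :=
    (φ.app r).toLinearEquiv.toEquiv.subsingleton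
  rw [Submodule.Quotient.subsingleton_iff] at hq
  rw [eq_top_iff, ← hq]
  exact Submodule.span_mono (Set.image_subset_range _ _)

theorem IsLexMinBase.image_isCritical (hX : IsGeodesicSpace X) (h : IsSLSC.{v, w} F X)
    (ha : IsLexMinBase.{v, w} F a) :
    (fun p : Set.Ioi (0 : ℝ) => ENNReal.ofReal p) ''
      {p | IsCritical (ripsPersistence.{v, w} F X) p} = Set.range fun i => (a i).length / 3 := by
  have hcrit := ha.1.isCritical_iff (quotientIsoRips F hX h ha.shortSpan_eq_shortLoopSpan)
  ext l
  constructor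
  · rintro ⟨p, hp, rfl⟩
    exact (hcrit p).1 hp
  · rintro ⟨i, rfl⟩
    obtain ⟨r, hr⟩ := exists_forall_dist_lt X
    have hr0 := ripsPersistence_subsingleton F hr
    -- Finiteness of `l_i`: at this scale all of `H₁(X; F)` is killed, so every base loop is short.
    have hlt : (a i).length / 3 < ENNReal.ofReal r := by
      rw [← ha.1.homologyClass_mem_shortSpan_iff, ha.shortSpan_eq_shortLoopSpan,
        ← ker_sampleHom F hX h]
      exact Subsingleton.elim _ _
    -- A loop of length `0` has zero class and cannot belong to a basis.
    have hne : (a i).length / 3 ≠ 0 := fun h0 => by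
      refine ha.1.linearIndependent.ne_zero i (homologyClass_eq_zero_of_length_eq_zero F (a i) ?_)
      simpa using ENNReal.div_eq_zero_iff.1 h0
    have he := ENNReal.ofReal_toReal hlt.ne_top
    exact ⟨⟨((a i).length / 3).toReal, ENNReal.toReal_pos hne hlt.ne_top⟩,
      (hcrit _).2 ⟨i, he.symm⟩, he⟩

end Equivalence

end

end GeodesicPersistence

open GeodesicPersistence
theorem mainTheorem8 (F : Type v) [Field F] (X : Type w) [MetricSpace X] [CompactSpace X]
    (hgeo : IsGeodesicSpace X) (hslsc : IsSLSC.{v, w} F X) (n : ℕ)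
    (hdim : Nonempty (H1.{v, w} F X ≃ₗ[F] (Fin n → F)))
    (a : Fin n → Loop X) (ha : ∀ i j, i < j → (a i).length ≤ (a j).length) :
    (IsLexMinBase.{v, w} F a ↔
      (∃ φ : quotientPersistence.{v, w} F a ≅ ripsPersistence.{v, w} F X, IsInducedBySamples φ) ∧
      Nonempty (quotientPersistence.{v, w} F a ≅
        directSum.{v, w} F fun i =>
          intervalPersistence F (Ioc0 ((a i).length / 3)) (ordConnected_Ioc0 _))) ∧
    (IsLexMinBase.{v, w} F a ↔
      Nonempty (quotientPersistence.{v, w} F a ≅ ripsPersistence.{v, w} F X) ∧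
      Nonempty (quotientPersistence.{v, w} F a ≅
        directSum.{v, w} F fun i =>
          intervalPersistence F (Ioc0 ((a i).length / 3)) (ordConnected_Ioc0 _))) ∧
    (IsLexMinBase.{v, w} F a →
      (fun p : Set.Ioi (0 : ℝ) => ENNReal.ofReal p) '' {p | IsCritical (ripsPersistence.{v, w} F X) p} =
        Set.range fun i => (a i).length / 3) := by
  have hmono : Monotone fun i => (a i).length := monotone_iff_forall_lt.2 fun i j => ha i j
  refine ⟨⟨fun h => ⟨⟨quotientIsoRips F hgeo hslsc h.shortSpan_eq_shortLoopSpan,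
      quotientIsoRips_isInducedBySamples F hgeo hslsc h.shortSpan_eq_shortLoopSpan⟩,
      ⟨quotientIsoDirectSum F h.1⟩⟩, ?_⟩,
    ⟨fun h => ⟨⟨quotientIsoRips F hgeo hslsc h.shortSpan_eq_shortLoopSpan⟩,
      ⟨quotientIsoDirectSum F h.1⟩⟩, ?_⟩, fun h => h.image_isCritical hgeo hslsc⟩
  · rintro ⟨⟨φ, -⟩, ⟨ψ⟩⟩
    exact isLexMinBase_of_iso hgeo hslsc hdim hmono φ ψ
  · rintro ⟨⟨φ⟩, ⟨ψ⟩⟩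
    exact isLexMinBase_of_iso hgeo hslsc hdim hmono φ ψ
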